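/- Graphs are finite and may have loops and multiple edges; a loop contributes $2$ to the degree of its vertex. For a graph $G$ and $A\subseteq V(G)$, let $e_G(A)$ be the number of edges (loops included) with both ends in $A$. A factor of $G$ is a spanning subgraph, and a graph is $m$-edge-connected if at least $m$ edges leave every nonempty proper subset of its vertex set. Let $k$ be a positive integer. A mapping $f:V(G)\to \mathbb{Z}_k$ is compatible with $G$ if for every partition of $V(G)$ into two (possibly empty) sets $X,Y$, either $\sum_{v\in X}f(v)-2x\equiv\sum_{v\in Y}f(v) \pmod k$ for some integer $x$ with $0\le x\le e_G(X)$, or $\sum_{v\in X}f(v)\equiv\sum_{v\in Y}f(v)-2y \pmod k$ for some integer $y$ with $0\le y\le e_G(Y)$. An $f$-factor of $G$ modulo $k$ is a factor $H$ of $G$ with $d_H(v)\equiv f(v)\pmod k$ for every $v\in V(G)$. Theorem. Let $G$ be a graph, let $k$ be a positive integer, and let $f:V(G)\to\mathbb{Z}_k$ be compatible with $G$. If $G$ contains a $(3k-3)$-edge-connected bipartite factor, then $G$ has an $f$-factor $H$ modulo $k$ such that for every vertex $v$, $$\left\lfloor \frac{d_G(v)}{2}\right\rfloor-(k-1)\le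 d_H(v)\le\left\lfloor \frac{d_G(v)}{2}\right\rfloor+k.$$ -/

import Mathlib

open scoped Graph

namespace ModuloFactor

/-- The degree of `v` in a multigraph: each incident edge counts once, each loop once more. -/
noncomputable def degree {α β : Type*} (G : Graph α β) (v : α) : ℕ :=
  {e | G.Inc e v}.ncard + {e | G.IsLoopAt e v}.ncard

/-- `e_G(A)`: the number of edges (loops included) with both ends in `A`. -/
noncomputable def edgesInside {α β : Type*} (G : Graph α β) (A : Set α) : ℕ :=
  {e | ∃ x ∈ A, ∃ y ∈ A, G.IsLink e x y}.ncard

/-- `d_G(A)`: the number of edges with exactly one end in `A`. -/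
noncomputable def cutSize {α β : Type*} (G : Graph α β) (A : Set α) : ℕ :=
  {e | ∃ x ∈ A, ∃ y ∉ A, G.IsLink e x y}.ncard

/-- `G` is `m`-edge-connected: every nonempty proper vertex subset has at least `m` edges
leaving it. -/
def IsEdgeConnected {α β : Type*} (G : Graph α β) (m : ℕ) : Prop :=
  ∀ A : Set α, A ⊆ V(G) → A.Nonempty → A ≠ V(G) → m ≤ cutSize G A

/-- `X, Y` is a bipartition of `V(G)`: disjoint sets, possibly empty, with union `V(G)`.
Nothing is required of the edges. -/
def IsVertexBipartition {α β : Type*} (G : Graph α β) (X Y : Set α) : Prop :=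
  Disjoint X Y ∧ X ∪ Y = V(G)

/-- `G` is bipartite: for some bipartition of the vertices, no edge has both ends in the
same part (so there are no loops). -/
def IsBipartite {α β : Type*} (G : Graph α β) : Prop :=
  ∃ X Y : Set α, IsVertexBipartition G X Y ∧
    ∀ e x y, G.IsLink e x y → (x ∈ X ∧ y ∈ Y) ∨ (x ∈ Y ∧ y ∈ X)

/-- `f` is compatible with `G` with respect to the bipartition `X, Y`. -/
def IsCompatibleWrt {α β : Type*} {k : ℕ} (G : Graph α β) (f : α → ZMod k)
    (X Y : Set α) : Prop :=
  (∃ x : ℕ, x ≤ edgesInside G X ∧ (∑ᶠ v ∈ X, f v) - 2 * (x : ZMod k) = ∑ᶠ v ∈ Y, f v) ∨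
  (∃ y : ℕ, y ≤ edgesInside G Y ∧ ∑ᶠ v ∈ X, f v = (∑ᶠ v ∈ Y, f v) - 2 * (y : ZMod k))

/-- `f` is compatible with `G`: it is so with respect to every bipartition of `V(G)`. -/
def IsCompatible {α β : Type*} {k : ℕ} (G : Graph α β) (f : α → ZMod k) : Prop :=
  ∀ X Y : Set α, IsVertexBipartition G X Y → IsCompatibleWrt G f X Y

/-- `H` is an `f`-factor of `G` modulo `k`: a spanning subgraph whose degrees are congruent
to `f` modulo `k`. -/
def IsModFactor {α β : Type*} {k : ℕ} (G : Graph α β) (f : α → ZMod k)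
    (H : Graph α β) : Prop :=
  H ≤s G ∧ ∀ v ∈ V(G), (degree H v : ZMod k) = f v

end ModuloFactor

/-! Choosing a factor `H` means giving every edge the sign `1` (in `H`) or `-1`. The signs at `v`,
loops counted twice, add up to `2 d_H(v) - d_G(v)`. So this sum must have the residue of `2 f(v) -
d_G(v)` modulo `2k` and lie in `(-2k, 2k]`.

Let `X, Y` be the sides of the bipartite factor, and multiply everything at `v` by `ε v = 1` on `X`
and `-1` on `Y`. An edge between the sides then contributes opposite amounts at its ends, like an
oriented edge (the family `N`). An edge inside a side contributes the same amount at both ends (the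
family `P`). The sum over all vertices is twice the sum of the signs on `P`, and compatibility with
respect to `X, Y` provides a number of positive signs on `P` that gives the right total.

If `P` has at most `k - 1` edges, its signs are fixed with that total. Each edge of `P` is replaced
by two edges from its ends to a new vertex, already oriented according to the sign, and it remains
to orient `N`. This is the extension theorem `IsAdmissible.exists_flow`: a preorientation at one
vertex of small degree extends to an orientation with prescribed net degrees modulo `2k`, all below
`2k` in absolute value. Its induction contracts tight cuts. Without tight cuts, every cut not formed
by a single vertex has two spare edges. These allow edges to be lifted at a vertex of target zero,
and single edges to be oriented and deleted when all targets are nonzero.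

If `P` is larger, two meeting edges `uv`, `vx` of `P` with opposite signs act as one edge `ux` of
`N`, so they can be merged. When no merging is possible, all but `k - 1` edges of `P` are pairwise
disjoint. Fixing their signs changes each net degree by at most `2`, in a direction that keeps the
asymmetric bounds (`IsSignable.exists_signs`).

For `k = 1` the congruences are void, and `exists_almost_balanced_signs` gives the bounds directly.
-/

namespace ModuloFactor

/-! ### Distance to the nearest multiple of `2 * k` -/

/-- The distance from `x` to the nearest multiple of `2 * k`. -/
def modNorm (k x : ℤ) : ℤ := min (x % (2 * k)) (2 * k - x % (2 * k))

section ModNorm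

variable {k : ℤ}

lemma modNorm_le_abs (hk : 0 < k) (x q : ℤ) : modNorm k x ≤ |x + 2 * k * q| := by
  have h1 := Int.emod_nonneg x (b := 2 * k) (by omega)
  have h3 := Int.mul_ediv_add_emod x (2 * k)
  have h4 := min_le_left (x % (2 * k)) (2 * k - x % (2 * k))
  have h5 := min_le_right (x % (2 * k)) (2 * k - x % (2 * k))
  unfold modNorm
  set r := x % (2 * k)
  set c := x / (2 * k)
  have e : x + 2 * k * q = 2 * k * (c + q) + r := by rw [← h3]; ring
  rw [e]
  rcases le_or_gt 0 (c + q) with h | h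
  · have := le_abs_self (2 * k * (c + q) + r)
    nlinarith
  · have := neg_le_abs (2 * k * (c + q) + r)
    have : c + q ≤ -1 := by omega
    nlinarith

/-- The representative of `x` modulo `2 * k` that lies in `(-k, k]`. -/
lemma exists_centered_rep (hk : 0 < k) (x : ℤ) :
    ∃ r, 2 * k ∣ x - r ∧ -k < r ∧ r ≤ k ∧ modNorm k x = |r| := by
  have h1 := Int.emod_nonneg x (b := 2 * k) (by omega)
  have h2 := Int.emod_lt_of_pos x (b := 2 * k) (by omega)
  have h3 := Int.mul_ediv_add_emod x (2 * k)
  rcases le_or_gt (x % (2 * k)) k with h | h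
  · refine ⟨x % (2 * k), ⟨x / (2 * k), by omega⟩, by omega, h, ?_⟩
    rw [modNorm, min_eq_left (by omega), abs_of_nonneg h1]
  · refine ⟨x % (2 * k) - 2 * k, ⟨x / (2 * k) + 1, by linarith⟩, by omega, by omega, ?_⟩
    rw [modNorm, min_eq_right (by omega), abs_of_nonpos (by omega)]
    ring

lemma modNorm_le_abs_of_dvd (hk : 0 < k) {x y : ℤ} (h : 2 * k ∣ x - y) : modNorm k x ≤ |y| := by
  obtain ⟨c, hc⟩ := h
  have := modNorm_le_abs hk x (-c)
  have e : x + 2 * k * -c = y := by linarith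
  rwa [e] at this

lemma modNorm_nonneg (hk : 0 < k) (x : ℤ) : 0 ≤ modNorm k x := by
  obtain ⟨r, -, -, -, h⟩ := exists_centered_rep hk x
  rw [h]; exact abs_nonneg r

lemma modNorm_le (hk : 0 < k) (x : ℤ) : modNorm k x ≤ k := by
  obtain ⟨r, -, h1, h2, h⟩ := exists_centered_rep hk x
  rw [h]; exact abs_le.2 ⟨h1.le, h2⟩

lemma modNorm_le_of_dvd_sub (hk : 0 < k) {x y : ℤ} (h : 2 * k ∣ x - y) :
    modNorm k x ≤ modNorm k y := by
  obtain ⟨r, hr, -, -, h'⟩ := exists_centered_rep hk y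
  rw [h']
  exact modNorm_le_abs_of_dvd hk (by simpa using dvd_add h hr)

lemma modNorm_congr (hk : 0 < k) {x y : ℤ} (h : 2 * k ∣ x - y) : modNorm k x = modNorm k y :=
  le_antisymm (modNorm_le_of_dvd_sub hk h)
    (modNorm_le_of_dvd_sub hk (by rw [← neg_sub]; exact h.neg_right))

lemma modNorm_add_le_abs (hk : 0 < k) (x y : ℤ) : modNorm k (x + y) ≤ modNorm k x + |y| := by
  obtain ⟨r, hr, -, -, h⟩ := exists_centered_rep hk x
  have h1 : modNorm k (x + y) ≤ |r + y| := modNorm_le_abs_of_dvd hk (by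
    have : x + y - (r + y) = x - r := by ring
    rwa [this])
  rw [h]
  exact h1.trans (abs_add_le r y)

lemma modNorm_add_le (hk : 0 < k) (x y : ℤ) :
    modNorm k (x + y) ≤ modNorm k x + modNorm k y := by
  obtain ⟨r, hr, -, -, h⟩ := exists_centered_rep hk y
  have h1 := modNorm_add_le_abs hk x r
  have h2 : modNorm k (x + y) ≤ modNorm k (x + r) := modNorm_le_of_dvd_sub hk (by
    have : x + y - (x + r) = y - r := by ring
    rwa [this])
  rw [h]
  exact h2.trans h1

lemma modNorm_neg (hk : 0 < k) (x : ℤ) : modNorm k (-x) = modNorm k x := by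
  have key : ∀ x, modNorm k (-x) ≤ modNorm k x := fun x => by
    obtain ⟨r, hr, -, -, h⟩ := exists_centered_rep hk x
    rw [h, ← abs_neg r]
    refine modNorm_le_abs_of_dvd hk ?_
    have : -x - -r = -(x - r) := by ring
    rw [this]; exact hr.neg_right
  refine le_antisymm (key x) ?_
  simpa using key (-x)

/-- Since `2 * k` is even, the norm keeps the parity of `x`. This parity is what later turns one
spare edge of a cut into two. -/
lemma two_dvd_modNorm_sub (hk : 0 < k) (x : ℤ) : 2 ∣ modNorm k x - x := by
  obtain ⟨r, ⟨c, hc⟩, -, -, h⟩ := exists_centered_rep hk x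
  rw [h]
  have e : x = r + 2 * (k * c) := by linarith
  generalize k * c = z at e
  rcases abs_choice r with h | h <;> rw [h] <;> omega

/-- If `|D|` were at least `2 * k`, moving `D` towards zero by `2 * k` would show that its norm is
at most `|D| - 2 * k`, against the hypothesis. This yields the bound `2 * k - 1` on net degrees from
a bound on the number of edges. -/
lemma abs_lt_of_le_modNorm (hk : 0 < k) {D : ℤ} (h : |D| ≤ 2 * k - 2 + modNorm k D) :
    |D| ≤ 2 * k - 1 := by
  have h1 := modNorm_le hk D
  by_contra! hc
  have h2 : modNorm k D ≤ |D| - 2 * k := by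
    rcases abs_choice D with e | e
    · have := modNorm_le_abs_of_dvd hk (x := D) (y := D - 2 * k) ⟨1, by ring⟩
      rw [abs_of_nonneg (by omega : 0 ≤ D - 2 * k)] at this
      omega
    · have := modNorm_le_abs_of_dvd hk (x := D) (y := D + 2 * k) ⟨-1, by ring⟩
      rw [abs_of_nonpos (by omega : D + 2 * k ≤ 0)] at this
      omega
  omega

end ModNorm

/-! ### Splitting an integer along a family of bounds -/

/-- Distributes the net flow of a bundle of edges over the parallel classes `m i` that form it; the
parity condition says that each class is fully oriented. -/
lemma exists_split {ι : Type*} [DecidableEq ι] (A : Finset ι) (m : ι → ℤ) (hm : ∀ i ∈ A, 0 ≤ m i)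
    (p : ℤ) (hp : |p| ≤ ∑ i ∈ A, m i) (hpar : 2 ∣ ∑ i ∈ A, m i - p) :
    ∃ q : ι → ℤ, (∀ i ∈ A, |q i| ≤ m i ∧ 2 ∣ m i - q i) ∧ ∑ i ∈ A, q i = p := by
  induction A using Finset.induction_on generalizing p with
  | empty =>
    refine ⟨fun _ => 0, by simp, ?_⟩
    simp at hp ⊢
    exact hp.symm
  | insert a A ha ih =>
    rw [Finset.sum_insert ha] at hp hpar
    have h0 : 0 ≤ m a := hm a (Finset.mem_insert_self a A)
    have hM : 0 ≤ ∑ i ∈ A, m i :=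
      Finset.sum_nonneg fun i hi => hm i (Finset.mem_insert_of_mem hi)
    set M := ∑ i ∈ A, m i
    obtain ⟨x, hx1, hx2, hx3⟩ : ∃ x, |x| ≤ m a ∧ 2 ∣ m a - x ∧ |p - x| ≤ M := by
      rw [abs_le] at hp
      -- Greedy choice: `x` is the smaller of `m a` and `p + M`. In the first case the term `max 0
      -- _` is zero.
      rcases le_or_gt (m a) (p + M) with h | h
      · exact ⟨m a - 2 * max 0 ((m a - p + M) / 2 - M), by
          rw [abs_le]; omega, by omega, by rw [abs_le]; omega⟩
      · exact ⟨p + M, by rw [abs_le]; omega, by omega, by rw [abs_le]; omega⟩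
    obtain ⟨q, hq, hs⟩ := ih (fun i hi => hm i (Finset.mem_insert_of_mem hi)) (p - x) hx3 (by omega)
    refine ⟨Function.update q a x, ?_, ?_⟩
    · intro i hi
      rcases eq_or_ne i a with rfl | hne
      · simp [hx1, hx2]
      · rw [Function.update_of_ne hne]
        exact hq i (Finset.mem_of_mem_insert_of_ne hi hne)
    · rw [Finset.sum_insert ha, Finset.sum_update_of_notMem ha, hs]
      simp

/-! ### Orientations with a prescribed vertex

A multigraph on the vertex set `S` together with one further vertex `z` is recorded by the
multiplicities `m u v` of the edges inside `S` and the number `w v` of edges between `v` and `z`.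
The edges at `z` are oriented in advance, `ψ v` being the net number of them leaving `v`.
An orientation of the rest is recorded by the antisymmetric net flow `φ`. -/

section Orientation

variable {V : Type*} [DecidableEq V]

/-- The number of edges leaving `A`. -/
def cutWeight (m : V → V → ℤ) (w : V → ℤ) (S A : Finset V) : ℤ :=
  ∑ a ∈ A, ∑ b ∈ S \ A, m a b + ∑ a ∈ A, w a

/-- The hypotheses of the extension theorem; `v₀` is a vertex of target zero which is exempt from
the lower bound on its degree. -/
structure IsAdmissible (k : ℤ) (S : Finset V) (m : V → V → ℤ) (w ψ t : V → ℤ) (v₀ : V) :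
    Prop where
  symm : ∀ u v, m u v = m v u
  diag : ∀ v, m v v = 0
  nonneg : ∀ u v, 0 ≤ m u v
  abs_le : ∀ v ∈ S, |ψ v| ≤ w v
  parity : ∀ v ∈ S, 2 ∣ w v - ψ v
  target_parity : ∀ v ∈ S, 2 ∣ ∑ u ∈ S, m v u + w v - t v
  sum_target : 2 * k ∣ ∑ v ∈ S, t v - ∑ v ∈ S, ψ v
  degree_le : ∑ v ∈ S, w v ≤ 2 * k - 2 + modNorm k (∑ v ∈ S, ψ v)
  zero : v₀ ∈ S → 2 * k ∣ t v₀
  le_cut : ∀ A ⊆ S, A.Nonempty → A ≠ S → A ≠ {v₀} →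
    2 * k - 2 + modNorm k (∑ v ∈ A, t v) ≤ cutWeight m w S A

/-- `φ` is the net flow of an orientation with out-degree minus in-degree congruent to `t`
modulo `2 * k` and smaller than `2 * k` in absolute value. -/
structure IsBalancedFlow (k : ℤ) (S : Finset V) (m : V → V → ℤ) (ψ t : V → ℤ)
    (φ : V → V → ℤ) : Prop where
  antisymm : ∀ u v, φ u v = -φ v u
  abs_le : ∀ u ∈ S, ∀ v ∈ S, |φ u v| ≤ m u v
  parity : ∀ u ∈ S, ∀ v ∈ S, 2 ∣ m u v - φ u v
  congr : ∀ v ∈ S, 2 * k ∣ ∑ u ∈ S, φ v u + ψ v - t v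
  bound : ∀ v ∈ S, |∑ u ∈ S, φ v u + ψ v| ≤ 2 * k - 1

lemma two_dvd_sum_sum {m : V → V → ℤ} (hs : ∀ u v, m u v = m v u) (hd : ∀ v, m v v = 0)
    (A : Finset V) : 2 ∣ ∑ a ∈ A, ∑ b ∈ A, m a b := by
  induction A using Finset.induction_on with
  | empty => simp
  | insert a A ha ih =>
    have e : ∑ x ∈ insert a A, ∑ b ∈ insert a A, m x b
        = ∑ x ∈ A, ∑ b ∈ A, m x b + 2 * ∑ b ∈ A, m a b := by
      rw [Finset.sum_insert ha, Finset.sum_insert ha, hd]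
      have : ∀ x ∈ A, ∑ b ∈ insert a A, m x b = m a x + ∑ b ∈ A, m x b := fun x _ => by
        rw [Finset.sum_insert ha, hs x a]
      rw [Finset.sum_congr rfl this, Finset.sum_add_distrib]
      ring
    rw [e]
    exact dvd_add ih ⟨_, rfl⟩

lemma sum_eq_add_sum_sdiff {A S : Finset V} (h : A ⊆ S) (g : V → ℤ) :
    ∑ v ∈ S, g v = ∑ v ∈ A, g v + ∑ v ∈ S \ A, g v := by
  rw [add_comm, Finset.sum_sdiff h]

lemma cutWeight_add_inner {m : V → V → ℤ} {w : V → ℤ} {A S : Finset V} (h : A ⊆ S) :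
    cutWeight m w S A + ∑ a ∈ A, ∑ b ∈ A, m a b = ∑ a ∈ A, (∑ b ∈ S, m a b + w a) := by
  rw [cutWeight, Finset.sum_add_distrib,
    Finset.sum_congr rfl fun a _ => sum_eq_add_sum_sdiff h (m a), Finset.sum_add_distrib]
  ring

lemma cutWeight_add_compl {m : V → V → ℤ} (hs : ∀ u v, m u v = m v u) {w : V → ℤ}
    {A S : Finset V} (h : A ⊆ S) :
    cutWeight m w S A + cutWeight m w S (S \ A)
      = 2 * ∑ a ∈ A, ∑ b ∈ S \ A, m a b + ∑ v ∈ S, w v := by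
  rw [cutWeight, cutWeight, Finset.sdiff_sdiff_eq_self h, Finset.sum_comm (s := S \ A),
    sum_eq_add_sum_sdiff h w]
  have : ∑ x ∈ A, ∑ y ∈ S \ A, m y x = ∑ x ∈ A, ∑ y ∈ S \ A, m x y :=
    Finset.sum_congr rfl fun x _ => Finset.sum_congr rfl fun y _ => hs y x
  linarith

namespace IsAdmissible

variable {k : ℤ} {S : Finset V} {m : V → V → ℤ} {w ψ t : V → ℤ} {v₀ : V}

/-- Handshake argument: targets have the parity of the degrees, and edges inside `A` count twice in
the degree sum. -/
lemma two_dvd_cutWeight_sub (h : IsAdmissible k S m w ψ t v₀) {A : Finset V} (hA : A ⊆ S) :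
    2 ∣ cutWeight m w S A - ∑ v ∈ A, t v := by
  have h1 := cutWeight_add_inner (m := m) (w := w) hA
  have h2 := two_dvd_sum_sum h.symm h.diag A
  have h3 : 2 ∣ ∑ a ∈ A, (∑ b ∈ S, m a b + w a - t a) :=
    Finset.dvd_sum fun a ha => h.target_parity a (hA ha)
  rw [Finset.sum_sub_distrib] at h3
  omega

lemma weight_nonneg (h : IsAdmissible k S m w ψ t v₀) {v : V} (hv : v ∈ S) : 0 ≤ w v :=
  (abs_nonneg _).trans (h.abs_le v hv)

/-- If an admissible cut has more than the minimal number of edges, it has two more. -/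
lemma add_two_le_cut (hk : 0 < k) (h : IsAdmissible k S m w ψ t v₀) {A : Finset V} (hA : A ⊆ S)
    (hlt : 2 * k - 2 + modNorm k (∑ v ∈ A, t v) < cutWeight m w S A) :
    2 * k + modNorm k (∑ v ∈ A, t v) ≤ cutWeight m w S A := by
  have h1 := h.two_dvd_cutWeight_sub hA
  have h2 := two_dvd_modNorm_sub hk (∑ v ∈ A, t v)
  omega

end IsAdmissible

/-! #### Contraction of a tight set -/

/-- The sum of `g` over `A` placed at the vertex `a`. -/
def lump (A : Finset V) (a : V) (g : V → ℤ) (v : V) : ℤ := if v = a then ∑ x ∈ A, g x else g v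

/-- The multiplicities after the contraction of `A` to the vertex `a`. -/
def lumpEdges (A : Finset V) (a : V) (m : V → V → ℤ) (u v : V) : ℤ :=
  if u = v then 0 else if u = a then ∑ x ∈ A, m x v else if v = a then ∑ x ∈ A, m u x else m u v

lemma sum_lump_of_notMem {A B : Finset V} {a : V} (ha : a ∉ B) (g : V → ℤ) :
    ∑ v ∈ B, lump A a g v = ∑ v ∈ B, g v :=
  Finset.sum_congr rfl fun v hv => by rw [lump, if_neg (by rintro rfl; exact ha hv)]

lemma sum_lump_insert {A B : Finset V} {a : V} (ha : a ∉ B) (hAB : Disjoint A B) (g : V → ℤ) :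
    ∑ v ∈ insert a B, lump A a g v = ∑ v ∈ A ∪ B, g v := by
  rw [Finset.sum_insert ha, sum_lump_of_notMem ha, Finset.sum_union hAB, lump, if_pos rfl]

lemma cutWeight_lump_of_notMem {A B S : Finset V} {a : V} {m : V → V → ℤ} {w : V → ℤ}
    (hA : A ⊆ S) (ha : a ∈ A) (hB : B ⊆ S \ A) :
    cutWeight (lumpEdges A a m) (lump A a w) (insert a (S \ A)) B = cutWeight m w S B := by
  have haB : a ∉ B := fun h => (Finset.mem_sdiff.1 (hB h)).2 ha
  rw [cutWeight, cutWeight, sum_lump_of_notMem haB]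
  congr 1
  refine Finset.sum_congr rfl fun b hb => ?_
  have hbA := (Finset.mem_sdiff.1 (hB hb)).2
  have hba : b ≠ a := by rintro rfl; exact hbA ha
  have e1 : insert a (S \ A) \ B = insert a ((S \ A) \ B) := Finset.insert_sdiff_of_notMem _ haB
  have e2 : S \ B = A ∪ (S \ A) \ B := by
    ext x; simp only [Finset.mem_sdiff, Finset.mem_union]
    constructor
    · rintro ⟨h1, h2⟩; by_cases hx : x ∈ A <;> simp [*]
    · rintro (h | ⟨⟨h1, h2⟩, h3⟩)
      · exact ⟨hA h, fun hx => (Finset.mem_sdiff.1 (hB hx)).2 h⟩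
      · exact ⟨h1, h3⟩
  rw [e1, e2, Finset.sum_insert (by simp [ha]), Finset.sum_union]
  · congr 1
    · simp [lumpEdges, hba]
    · refine Finset.sum_congr rfl fun c hc => ?_
      simp only [Finset.mem_sdiff] at hc
      have h1 : b ≠ c := by rintro rfl; exact hc.2 hb
      have h2 : c ≠ a := by rintro rfl; exact hc.1.2 ha
      simp [lumpEdges, hba, h1, h2]
  · rw [Finset.disjoint_left]
    intro x hx; simp [hx]

lemma cutWeight_lump_insert {A B S : Finset V} {a : V} {m : V → V → ℤ} {w : V → ℤ}
    (ha : a ∈ A) (hB : B ⊆ S \ A) :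
    cutWeight (lumpEdges A a m) (lump A a w) (insert a (S \ A)) (insert a B)
      = cutWeight m w S (A ∪ B) := by
  have haB : a ∉ B := fun h => (Finset.mem_sdiff.1 (hB h)).2 ha
  have hd : Disjoint A B := by
    rw [Finset.disjoint_left]; intro x hx hxB; exact (Finset.mem_sdiff.1 (hB hxB)).2 hx
  rw [cutWeight, cutWeight, sum_lump_insert haB hd]
  congr 1
  have e1 : insert a (S \ A) \ insert a B = (S \ A) \ B := by
    ext x; simp only [Finset.mem_sdiff, Finset.mem_insert]
    constructor
    · rintro ⟨h1, h2⟩; tauto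
    · rintro ⟨⟨h1, h2⟩, h3⟩
      have : x ≠ a := by rintro rfl; exact h2 ha
      tauto
  have e2 : S \ (A ∪ B) = (S \ A) \ B := by
    ext x; simp only [Finset.mem_sdiff, Finset.mem_union]; tauto
  rw [e1, e2, Finset.sum_insert haB, Finset.sum_union hd]
  have hne : ∀ c ∈ (S \ A) \ B, c ≠ a := fun c hc => by
    simp only [Finset.mem_sdiff] at hc
    rintro rfl; exact hc.1.2 ha
  congr 1
  · rw [Finset.sum_comm]
    refine Finset.sum_congr rfl fun c hc => ?_
    simp [lumpEdges, (hne c hc).symm]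
  · refine Finset.sum_congr rfl fun b hb => Finset.sum_congr rfl fun c hc => ?_
    have h1 : b ≠ c := by rintro rfl; exact (Finset.mem_sdiff.1 hc).2 hb
    have h2 : b ≠ a := by rintro rfl; exact haB hb
    simp [lumpEdges, h1, h2, hne c hc]

/-- Every cut of the contracted graph is a cut of the original one, so the cut conditions are
inherited. Taking `a ≠ v₀` ensures that the contracted vertex does not become exempt. -/
lemma IsAdmissible.contract {k : ℤ} {S : Finset V} {m : V → V → ℤ} {w ψ t : V → ℤ} {v₀ : V}
    (h : IsAdmissible k S m w ψ t v₀) {A : Finset V} (hA : A ⊆ S) {a : V} (ha : a ∈ A)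
    (hav : a ≠ v₀) :
    IsAdmissible k (insert a (S \ A)) (lumpEdges A a m) (lump A a w) (lump A a ψ) (lump A a t)
      v₀ := by
  have haS : a ∉ S \ A := by simp [ha]
  have hd : Disjoint A (S \ A) := Finset.disjoint_sdiff
  have hAS : A ∪ S \ A = S := Finset.union_sdiff_of_subset hA
  have total : ∀ g : V → ℤ, ∑ v ∈ insert a (S \ A), lump A a g v = ∑ v ∈ S, g v := fun g => by
    rw [sum_lump_insert haS hd, hAS]
  have degree_out : ∀ v ∈ S \ A, ∑ u ∈ insert a (S \ A), lumpEdges A a m v u = ∑ u ∈ S, m v u := by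
    intro v hv
    have hva : v ≠ a := by rintro rfl; exact haS hv
    rw [Finset.sum_insert haS, sum_eq_add_sum_sdiff hA]
    congr 1
    · simp [lumpEdges, hva]
    · refine Finset.sum_congr rfl fun u hu => ?_
      have hua : u ≠ a := by rintro rfl; exact haS hu
      by_cases e : v = u
      · simp [lumpEdges, e, h.diag]
      · simp [lumpEdges, hva, hua, e]
  refine ⟨?_, ?_, ?_, ?_, ?_, ?_, ?_, ?_, ?_, ?_⟩
  · intro u v
    unfold lumpEdges
    by_cases h1 : u = v
    · simp [h1]
    · have h1' : v ≠ u := fun e => h1 e.symm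
      by_cases h2 : u = a
      · have h3 : v ≠ a := fun e => h1 (h2.trans e.symm)
        simp [h2, h3, Ne.symm h3, h.symm v]
      · by_cases h3 : v = a
        · simp [h2, h3, Ne.symm h2, h.symm u]
        · simp [h1, h1', h2, h3, h.symm u v]
  · intro v; simp [lumpEdges]
  · intro u v
    unfold lumpEdges
    split_ifs
    · exact le_rfl
    · exact Finset.sum_nonneg fun x _ => h.nonneg x v
    · exact Finset.sum_nonneg fun x _ => h.nonneg u x
    · exact h.nonneg u v
  · intro v hv
    unfold lump
    split_ifs with e
    · exact (Finset.abs_sum_le_sum_abs _ _).trans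
        (Finset.sum_le_sum fun x hx => h.abs_le x (hA hx))
    · exact h.abs_le v (Finset.mem_sdiff.1 (Finset.mem_of_mem_insert_of_ne hv e)).1
  · intro v hv
    unfold lump
    split_ifs with e
    · rw [← Finset.sum_sub_distrib]
      exact Finset.dvd_sum fun x hx => h.parity x (hA hx)
    · exact h.parity v (Finset.mem_sdiff.1 (Finset.mem_of_mem_insert_of_ne hv e)).1
  · intro v hv
    by_cases e : v = a
    · subst e
      have h1 := h.two_dvd_cutWeight_sub hA
      have h2 : ∑ u ∈ insert v (S \ A), lumpEdges A v m v u = ∑ x ∈ A, ∑ b ∈ S \ A, m x b := by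
        rw [Finset.sum_insert haS, Finset.sum_comm]
        simp only [lumpEdges, if_true, zero_add]
        refine Finset.sum_congr rfl fun u hu => ?_
        rw [if_neg (by rintro rfl; exact haS hu)]
      rw [h2]
      simpa [lump, cutWeight] using h1
    · have hv' := Finset.mem_of_mem_insert_of_ne hv e
      rw [degree_out v hv']
      simpa [lump, e] using h.target_parity v (Finset.mem_sdiff.1 hv').1
  · rw [total, total]; exact h.sum_target
  · rw [total, total]; exact h.degree_le
  · intro hv
    have hv' := Finset.mem_of_mem_insert_of_ne hv (Ne.symm hav)
    simpa [lump, Ne.symm hav] using h.zero (Finset.mem_sdiff.1 hv').1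
  · intro C hC hne hCS hC0
    by_cases haC : a ∈ C
    · have hB : C.erase a ⊆ S \ A := fun x hx =>
        Finset.mem_of_mem_insert_of_ne (hC (Finset.mem_of_mem_erase hx)) (Finset.ne_of_mem_erase hx)
      have hdB : Disjoint A (C.erase a) := Finset.disjoint_of_subset_right hB hd
      rw [← Finset.insert_erase haC, cutWeight_lump_insert ha hB,
        sum_lump_insert (Finset.notMem_erase a C) hdB]
      refine h.le_cut _ (Finset.union_subset hA (hB.trans Finset.sdiff_subset))
        ⟨a, Finset.mem_union_left _ ha⟩ ?_ ?_
      · intro e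
        apply hCS
        refine Finset.Subset.antisymm hC fun x hx => ?_
        rcases Finset.mem_insert.1 hx with rfl | hx
        · exact haC
        · have : x ∈ A ∪ C.erase a := e ▸ (Finset.mem_sdiff.1 hx).1
          rcases Finset.mem_union.1 this with h' | h'
          · exact absurd h' (Finset.mem_sdiff.1 hx).2
          · exact Finset.mem_of_mem_erase h'
      · intro e
        have : a ∈ ({v₀} : Finset V) := e ▸ Finset.mem_union_left _ ha
        exact hav (Finset.mem_singleton.1 this)
    · have hB : C ⊆ S \ A := fun x hx =>
        Finset.mem_of_mem_insert_of_ne (hC hx) (by rintro rfl; exact haC hx)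
      rw [cutWeight_lump_of_notMem hA ha hB, sum_lump_of_notMem haC]
      refine h.le_cut C (hB.trans Finset.sdiff_subset) hne ?_ hC0
      rintro rfl
      exact haC (hA ha)

/-- A cut of minimal size reduces the extension problem to its two sides. -/
lemma IsAdmissible.exists_flow_of_tight {k : ℤ} (hk : 0 < k) {S : Finset V} {m : V → V → ℤ}
    {w ψ t : V → ℤ} {v₀ : V} (h : IsAdmissible k S m w ψ t v₀) {A : Finset V} (hA : A ⊆ S)
    (hcard : 2 ≤ A.card) (hAS : A ≠ S)
    (htight : cutWeight m w S A ≤ 2 * k - 2 + modNorm k (∑ v ∈ A, t v))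
    (ih : ∀ (S' : Finset V) (m' : V → V → ℤ) (w' ψ' t' : V → ℤ), S'.card < S.card →
      IsAdmissible k S' m' w' ψ' t' v₀ → ∃ φ, IsBalancedFlow k S' m' ψ' t' φ) :
    ∃ φ, IsBalancedFlow k S m ψ t φ := by
  obtain ⟨a, ha, hav⟩ : ∃ a ∈ A, a ≠ v₀ := by
    by_contra! hc
    have := Finset.card_le_card (show A ⊆ {v₀} from fun x hx => by simpa using hc x hx)
    simp at this; omega
  have hAlt : A.card < S.card := Finset.card_lt_card (hA.ssubset_of_ne hAS)
  have haS : a ∉ S \ A := by simp [ha]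
  have hS' : (insert a (S \ A)).card < S.card := by
    rw [Finset.card_insert_of_notMem haS, Finset.card_sdiff_of_subset hA]; omega
  obtain ⟨φ₁, h₁⟩ := ih _ _ _ _ _ hS' (h.contract hA ha hav)
  -- The flow between the contracted vertex and `u` is distributed over the edges from `A` to `u`.
  -- These edges are then prescribed edges for the problem inside `A`, with the outside shrunk to
  -- the prescribed vertex.
  have hsplit : ∀ u ∈ S \ A, ∃ q : V → ℤ,
      (∀ x ∈ A, |q x| ≤ m x u ∧ 2 ∣ m x u - q x) ∧ ∑ x ∈ A, q x = φ₁ a u := by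
    intro u hu
    have hua : a ≠ u := by rintro rfl; exact haS hu
    have e : lumpEdges A a m a u = ∑ x ∈ A, m x u := by simp [lumpEdges, hua]
    have h3 := h₁.abs_le a (Finset.mem_insert_self _ _) u (Finset.mem_insert_of_mem hu)
    have h4 := h₁.parity a (Finset.mem_insert_self _ _) u (Finset.mem_insert_of_mem hu)
    rw [e] at h3 h4
    exact exists_split A (fun x => m x u) (fun x _ => h.nonneg x u) _ h3 h4
  choose! q hq hqs using hsplit
  have hcong : 2 * k ∣ ∑ v ∈ A, t v - ∑ x ∈ A, (ψ x + ∑ u ∈ S \ A, q u x) := by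
    have h3 := h₁.congr a (Finset.mem_insert_self _ _)
    have h0 : φ₁ a a = 0 := by have := h₁.antisymm a a; omega
    rw [Finset.sum_insert haS, h0, zero_add, lump, lump, if_pos rfl, if_pos rfl] at h3
    rw [Finset.sum_add_distrib, Finset.sum_comm, Finset.sum_congr rfl hqs, ← neg_sub]
    rw [add_comm (∑ u ∈ S \ A, φ₁ a u)] at h3
    exact dvd_neg.2 h3
  have hinner : IsAdmissible k A m (fun x => w x + ∑ u ∈ S \ A, m x u)
      (fun x => ψ x + ∑ u ∈ S \ A, q u x) t v₀ := by
    refine ⟨h.symm, h.diag, h.nonneg, ?_, ?_, ?_, hcong, ?_, fun hv => h.zero (hA hv), ?_⟩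
    · intro x hx
      refine (abs_add_le _ _).trans (add_le_add (h.abs_le x (hA hx)) ?_)
      exact (Finset.abs_sum_le_sum_abs _ _).trans
        (Finset.sum_le_sum fun u hu => (hq u hu x hx).1)
    · intro x hx
      have h3 := h.parity x (hA hx)
      have h4 : 2 ∣ ∑ u ∈ S \ A, (m x u - q u x) := Finset.dvd_sum fun u hu => (hq u hu x hx).2
      rw [Finset.sum_sub_distrib] at h4
      omega
    · intro x hx
      have h3 := h.target_parity x (hA hx)
      rw [sum_eq_add_sum_sdiff hA] at h3
      convert h3 using 1
      ring
    -- The prescribed vertex now has degree `cutWeight m w S A`; tightness of `A` is the bound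
    -- required of it.
    · rw [← modNorm_congr hk hcong, Finset.sum_add_distrib, add_comm (∑ x ∈ A, w x)]
      exact htight
    · intro B hB hne hBA hB0
      have := h.le_cut B (hB.trans hA) hne (by rintro rfl; exact hBA (hB.antisymm hA)) hB0
      refine this.trans_eq ?_
      rw [cutWeight, cutWeight, Finset.sum_add_distrib]
      have e : ∀ b ∈ B, ∑ c ∈ S \ B, m b c = ∑ c ∈ A \ B, m b c + ∑ c ∈ S \ A, m b c := by
        intro b _
        rw [← Finset.sum_union]
        · congr 1
          ext x; simp only [Finset.mem_sdiff, Finset.mem_union]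
          constructor
          · rintro ⟨h1, h2⟩; by_cases hx : x ∈ A <;> simp [*]
          · rintro (⟨h1, h2⟩ | ⟨h1, h2⟩)
            · exact ⟨hA h1, h2⟩
            · exact ⟨h1, fun hx => h2 (hB hx)⟩
        · rw [Finset.disjoint_left]; intro x hx hx'
          exact (Finset.mem_sdiff.1 hx').2 (Finset.mem_sdiff.1 hx).1
      rw [Finset.sum_congr rfl e, Finset.sum_add_distrib]
      ring
  obtain ⟨φ₂, h₂⟩ := ih _ _ _ _ _ hAlt hinner
  let φ : V → V → ℤ := fun u v =>
    if u ∈ A then (if v ∈ A then φ₂ u v else q v u) else (if v ∈ A then -q u v else φ₁ u v)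
  have hin : ∀ v ∈ A, ∑ u ∈ S, φ v u + ψ v
      = ∑ u ∈ A, φ₂ v u + (ψ v + ∑ u ∈ S \ A, q u v) := by
    intro v hv
    rw [sum_eq_add_sum_sdiff hA,
      Finset.sum_congr (g := φ₂ v) rfl fun u hu => by simp [φ, hv, hu],
      Finset.sum_congr (s₁ := S \ A) (g := fun u => q u v) rfl fun u hu => by
        simp [φ, hv, (Finset.mem_sdiff.1 hu).2]]
    ring
  have hout : ∀ v ∈ S, v ∉ A → ∑ u ∈ S, φ v u + ψ v
      = ∑ u ∈ insert a (S \ A), φ₁ v u + lump A a ψ v := by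
    intro v hv hvA
    have hva : v ≠ a := by rintro rfl; exact hvA ha
    have hv' : v ∈ S \ A := Finset.mem_sdiff.2 ⟨hv, hvA⟩
    rw [sum_eq_add_sum_sdiff hA,
      Finset.sum_congr (g := fun u => -q v u) rfl fun u hu => by simp [φ, hvA, hu],
      Finset.sum_congr (s₁ := S \ A) (g := φ₁ v) rfl fun u hu => by
        simp [φ, hvA, (Finset.mem_sdiff.1 hu).2],
      Finset.sum_insert haS, h₁.antisymm v a, Finset.sum_neg_distrib, hqs v hv']
    simp [lump, hva]
  have hmem : ∀ v ∈ S, v ∉ A → v ∈ insert a (S \ A) := fun v hv hvA =>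
    Finset.mem_insert_of_mem (Finset.mem_sdiff.2 ⟨hv, hvA⟩)
  have hedge : ∀ u ∈ S, u ∉ A → ∀ v ∈ S, v ∉ A → lumpEdges A a m u v = m u v := by
    intro u _ huA v _ hvA
    have hua : u ≠ a := by rintro rfl; exact huA ha
    have hva : v ≠ a := by rintro rfl; exact hvA ha
    by_cases e : u = v
    · simp [lumpEdges, e, h.diag]
    · simp [lumpEdges, e, hua, hva]
  refine ⟨φ, ?_, ?_, ?_, ?_, ?_⟩
  · intro u v
    by_cases hu : u ∈ A <;> by_cases hv : v ∈ A <;> simp only [φ, hu, hv, if_true, if_false]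
    · exact h₂.antisymm u v
    · simp
    · exact h₁.antisymm u v
  · intro u hu v hv
    by_cases hu' : u ∈ A <;> by_cases hv' : v ∈ A <;> simp only [φ, hu', hv', if_true, if_false]
    · exact h₂.abs_le u hu' v hv'
    · exact (hq v (Finset.mem_sdiff.2 ⟨hv, hv'⟩) u hu').1
    · rw [abs_neg, h.symm]; exact (hq u (Finset.mem_sdiff.2 ⟨hu, hu'⟩) v hv').1
    · rw [← hedge u hu hu' v hv hv']
      exact h₁.abs_le u (hmem u hu hu') v (hmem v hv hv')
  · intro u hu v hv
    by_cases hu' : u ∈ A <;> by_cases hv' : v ∈ A <;> simp only [φ, hu', hv', if_true, if_false]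
    · exact h₂.parity u hu' v hv'
    · exact (hq v (Finset.mem_sdiff.2 ⟨hv, hv'⟩) u hu').2
    · have := (hq u (Finset.mem_sdiff.2 ⟨hu, hu'⟩) v hv').2
      rw [h.symm]; omega
    · rw [← hedge u hu hu' v hv hv']
      exact h₁.parity u (hmem u hu hu') v (hmem v hv hv')
  · intro v hv
    by_cases hvA : v ∈ A
    · rw [hin v hvA]; exact h₂.congr v hvA
    · rw [hout v hv hvA]
      have hva : v ≠ a := by rintro rfl; exact hvA ha
      have := h₁.congr v (hmem v hv hvA)
      simpa [lump, hva] using this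
  · intro v hv
    by_cases hvA : v ∈ A
    · rw [hin v hvA]; exact h₂.bound v hvA
    · rw [hout v hv hvA]; exact h₁.bound v (hmem v hv hvA)

end Orientation

section Moves

variable {V : Type*} [DecidableEq V]

/-! #### Modifying single edges -/

/-- The multiplicity function of a single edge `uv`. -/
def edgeInd (u v a b : V) : ℤ :=
  (if a = u ∧ b = v then 1 else 0) + (if a = v ∧ b = u then 1 else 0)

/-- The flow of a single edge oriented from `u` to `v`. -/
def arcInd (u v a b : V) : ℤ :=
  (if a = u ∧ b = v then 1 else 0) - (if a = v ∧ b = u then 1 else 0)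

/-- The indicator function of the vertex `u`. -/
def vertInd (u a : V) : ℤ := if a = u then 1 else 0

lemma edgeInd_comm (u v a b : V) : edgeInd u v a b = edgeInd u v b a := by
  unfold edgeInd; rw [add_comm]; simp only [and_comm]

lemma arcInd_antisymm (u v a b : V) : arcInd u v a b = -arcInd u v b a := by
  unfold arcInd; simp only [and_comm]; ring

lemma edgeInd_diag {u v : V} (h : u ≠ v) (a : V) : edgeInd u v a a = 0 := by
  unfold edgeInd
  rw [if_neg (by rintro ⟨rfl, e⟩; exact h e), if_neg (by rintro ⟨rfl, e⟩; exact h e.symm)]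
  rfl

lemma edgeInd_nonneg (u v a b : V) : 0 ≤ edgeInd u v a b := by
  unfold edgeInd; split_ifs <;> simp

lemma edgeInd_eq_one_or {u v : V} (h : u ≠ v) (a b : V) :
    (edgeInd u v a b = 0 ∧ arcInd u v a b = 0) ∨
      (edgeInd u v a b = 1 ∧ (a = u ∧ b = v ∧ arcInd u v a b = 1 ∨
        a = v ∧ b = u ∧ arcInd u v a b = -1)) := by
  unfold edgeInd arcInd
  by_cases h1 : a = u ∧ b = v
  · have h2 : ¬(a = v ∧ b = u) := by rintro ⟨e, -⟩; exact h (h1.1.symm.trans e)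
    simp [h1, h]
  · by_cases h2 : a = v ∧ b = u
    · simp [h2, h.symm]
    · simp [h1, h2]

lemma sum_vertInd {A : Finset V} (u : V) : ∑ a ∈ A, vertInd u a = if u ∈ A then 1 else 0 := by
  simp [vertInd]

lemma sum_edgeInd {u v : V} (A : Finset V) (a : V) :
    ∑ b ∈ A, edgeInd u v a b
      = (if v ∈ A then vertInd u a else 0) + if u ∈ A then vertInd v a else 0 := by
  unfold edgeInd vertInd
  rw [Finset.sum_add_distrib]
  congr 1
  · by_cases h : a = u <;> simp [h]
  · by_cases h : a = v <;> simp [h]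

lemma sum_arcInd {u v : V} {S : Finset V} (hu : u ∈ S) (hv : v ∈ S) (a : V) :
    ∑ b ∈ S, arcInd u v a b = vertInd u a - vertInd v a := by
  unfold arcInd vertInd
  rw [Finset.sum_sub_distrib]
  congr 1
  · by_cases h : a = u <;> simp [h, hv]
  · by_cases h : a = v <;> simp [h, hu]

lemma sum_sum_edgeInd {u v : V} {S : Finset V} (hu : u ∈ S) (hv : v ∈ S) :
    ∑ a ∈ S, ∑ b ∈ S, edgeInd u v a b = 2 := by
  simp_rw [sum_edgeInd, if_pos hu, if_pos hv, Finset.sum_add_distrib, sum_vertInd, if_pos hu,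
    if_pos hv]
  rfl

lemma cut_edgeInd {u v : V} {S A : Finset V} (hu : u ∈ S) (hv : v ∈ S) :
    ∑ a ∈ A, ∑ b ∈ S \ A, edgeInd u v a b = if (u ∈ A ↔ v ∈ A) then 0 else 1 := by
  simp_rw [sum_edgeInd, Finset.sum_add_distrib, Finset.mem_sdiff]
  by_cases h1 : u ∈ A <;> by_cases h2 : v ∈ A <;> simp [h1, h2, hu, hv, sum_vertInd]

lemma cutWeight_add_edge {m : V → V → ℤ} {w : V → ℤ} {u v : V} {S A : Finset V} (hu : u ∈ S)
    (hv : v ∈ S) (c : ℤ) :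
    cutWeight (fun a b => m a b + c * edgeInd u v a b) w S A
      = cutWeight m w S A + c * if (u ∈ A ↔ v ∈ A) then 0 else 1 := by
  rw [cutWeight, cutWeight, ← cut_edgeInd hu hv]
  simp_rw [Finset.sum_add_distrib, Finset.mul_sum]
  ring

lemma sum_add_vertInd {A : Finset V} (g : V → ℤ) (u : V) (c : ℤ) :
    ∑ a ∈ A, (g a + c * vertInd u a) = ∑ a ∈ A, g a + c * if u ∈ A then 1 else 0 := by
  rw [Finset.sum_add_distrib, ← Finset.mul_sum, sum_vertInd]

lemma cutWeight_add_vert {m : V → V → ℤ} {w : V → ℤ} {u : V} {S A : Finset V} (c : ℤ) :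
    cutWeight m (fun a => w a + c * vertInd u a) S A
      = cutWeight m w S A + c * if u ∈ A then 1 else 0 := by
  rw [cutWeight, cutWeight, sum_add_vertInd]
  ring

variable {k : ℤ} {S : Finset V} {m : V → V → ℤ} {w ψ t : V → ℤ} {v₀ : V}

/-! #### Reversal -/

lemma IsAdmissible.neg (hk : 0 < k) (h : IsAdmissible k S m w ψ t v₀) :
    IsAdmissible k S m w (fun v => -ψ v) (fun v => -t v) v₀ := by
  refine ⟨h.symm, h.diag, h.nonneg, ?_, ?_, ?_, ?_, ?_, ?_, ?_⟩
  · intro v hv; rw [abs_neg]; exact h.abs_le v hv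
  · intro v hv; have := h.parity v hv; omega
  · intro v hv; have := h.target_parity v hv; omega
  · rw [Finset.sum_neg_distrib, Finset.sum_neg_distrib]
    obtain ⟨c, hc⟩ := h.sum_target
    exact ⟨-c, by linarith⟩
  · rw [Finset.sum_neg_distrib, modNorm_neg hk]; exact h.degree_le
  · intro hv; exact (h.zero hv).neg_right
  · intro A h1 h2 h3 h4
    rw [Finset.sum_neg_distrib, modNorm_neg hk]
    exact h.le_cut A h1 h2 h3 h4

lemma IsBalancedFlow.neg {V : Type*} {S : Finset V} {m : V → V → ℤ} {ψ t : V → ℤ} {φ : V → V → ℤ}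
    (h : IsBalancedFlow k S m (fun v => -ψ v) (fun v => -t v) φ) :
    IsBalancedFlow k S m ψ t (fun u v => -φ u v) := by
  refine ⟨?_, ?_, ?_, ?_, ?_⟩
  · intro u v; rw [h.antisymm u v]
  · intro u hu v hv; rw [abs_neg]; exact h.abs_le u hu v hv
  · intro u hu v hv; have := h.parity u hu v hv; omega
  · intro v hv
    obtain ⟨c, hc⟩ := h.congr v hv
    rw [Finset.sum_neg_distrib]
    exact ⟨-c, by linarith⟩
  · intro v hv
    have := h.bound v hv
    rw [Finset.sum_neg_distrib, ← abs_neg]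
    convert this using 2
    ring

/-! #### Lifting two edges at an exempt vertex -/

/-- Every cut except those formed by one vertex has at least two edges more than required. -/
def HasSlack (k : ℤ) (S : Finset V) (m : V → V → ℤ) (w t : V → ℤ) : Prop :=
  ∀ A ⊆ S, 2 ≤ A.card → A ≠ S → 2 * k + modNorm k (∑ v ∈ A, t v) ≤ cutWeight m w S A

lemma two_le_card_of_ne_singleton {V : Type*} {A : Finset V} {v : V} (hv : v ∈ A) (h : A ≠ {v}) :
    2 ≤ A.card := by
  have : 0 < A.card := Finset.card_pos.2 ⟨v, hv⟩
  by_contra! hc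
  obtain ⟨a, rfl⟩ := Finset.card_eq_one.1 (by omega : A.card = 1)
  rw [Finset.mem_singleton] at hv
  exact h (by rw [hv])

/-- The edges `v₀x` and `v₀y` are replaced by `xy`; all degrees except that of `v₀` are unchanged,
and `v₀` is exempt. -/
lemma IsAdmissible.lift (h : IsAdmissible k S m w ψ t v₀) (hs : HasSlack k S m w t) {x y : V}
    (hv : v₀ ∈ S) (hx : x ∈ S) (hy : y ∈ S) (hvx : v₀ ≠ x) (hvy : v₀ ≠ y) (hxy : x ≠ y)
    (hmx : 0 < m v₀ x) (hmy : 0 < m v₀ y) :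
    IsAdmissible k S (fun a b => m a b + -1 * edgeInd v₀ x a b + -1 * edgeInd v₀ y a b
      + 1 * edgeInd x y a b) w ψ t v₀ := by
  refine ⟨?_, ?_, ?_, h.abs_le, h.parity, ?_, h.sum_target, h.degree_le, h.zero, ?_⟩
  · intro a b
    rw [h.symm a b, edgeInd_comm v₀ x, edgeInd_comm v₀ y, edgeInd_comm x y]
  · intro a
    rw [h.diag, edgeInd_diag hvx, edgeInd_diag hvy, edgeInd_diag hxy]; rfl
  · intro a b
    have h0 := h.nonneg a b
    have h1 := edgeInd_nonneg x y a b
    have hmx' := h.symm v₀ x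
    have hmy' := h.symm v₀ y
    rcases edgeInd_eq_one_or hvx a b with ⟨e, -⟩ | ⟨e, ⟨e1, e2, -⟩ | ⟨e1, e2, -⟩⟩ <;>
      rcases edgeInd_eq_one_or hvy a b with ⟨e', -⟩ | ⟨e', ⟨e1', e2', -⟩ | ⟨e1', e2', -⟩⟩ <;>
      first
        | (rw [e, e']; subst e1 e2; omega)
        | (rw [e, e']; subst e1' e2'; omega)
        | (rw [e, e']; omega)
        | exact absurd (e2.symm.trans e2') hxy
        | exact absurd (e1.symm.trans e1') hvy
        | exact absurd (e1'.symm.trans e1) hvx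
        | exact absurd (e1.symm.trans e1') hxy
  · intro a ha
    have := h.target_parity a ha
    simp_rw [Finset.sum_add_distrib, ← Finset.mul_sum, sum_edgeInd, if_pos hv, if_pos hx, if_pos hy]
    omega
  · intro A hA hne hAS hA0
    rw [cutWeight_add_edge hx hy, cutWeight_add_edge hv hy, cutWeight_add_edge hv hx]
    have h1 := h.le_cut A hA hne hAS hA0
    -- A cut loses at most two edges, which the slack covers. A single vertex other than `v₀` loses
    -- none.
    by_cases h2 : 2 ≤ A.card
    · have := hs A hA h2 hAS
      split_ifs <;> omega
    · by_cases hva : v₀ ∈ A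
      · exact absurd (two_le_card_of_ne_singleton hva hA0) h2
      · have : ¬(x ∈ A ∧ y ∈ A) := fun ⟨hxA, hyA⟩ =>
          h2 (two_le_card_of_ne_singleton hxA (by
            rintro rfl; exact hxy (Finset.mem_singleton.1 hyA).symm))
        split_ifs <;> first | omega | tauto

/-- Among `n + 1` parallel edges with net flow `a`, one edge gets a direction `s` such that the
other `n` can carry the rest. -/
lemma exists_sign (a n : ℤ) (h : |a| ≤ n + 1) (hp : 2 ∣ n + 1 - a) (hn : 0 ≤ n) :
    ∃ s : ℤ, |s| = 1 ∧ |a - s| ≤ n ∧ 2 ∣ n - (a - s) := by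
  rw [abs_le] at h
  rcases le_or_gt 0 a with h0 | h0
  · by_cases h1 : a = 0
    · exact ⟨1, by simp, by rw [abs_le]; omega, by omega⟩
    · exact ⟨1, by simp, by rw [abs_le]; omega, by omega⟩
  · exact ⟨-1, by simp, by rw [abs_le]; omega, by omega⟩

/-- One edge `xy`, with the direction found by `exists_sign`, is rerouted through `v`. No net degree
changes, not even at `v`. -/
lemma IsBalancedFlow.lift {φ : V → V → ℤ} {v x y : V} (hm : ∀ a b, 0 ≤ m a b)
    (hsymm : ∀ a b, m a b = m b a) (hv : v ∈ S) (hx : x ∈ S) (hy : y ∈ S) (hvx : v ≠ x) (hvy : v ≠ y) (hxy : x ≠ y)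
    (h : IsBalancedFlow k S (fun a b => m a b + -1 * edgeInd v x a b + -1 * edgeInd v y a b
      + 1 * edgeInd x y a b) ψ t φ) :
    ∃ φ, IsBalancedFlow k S m ψ t φ := by
  have exy : edgeInd x y x y = 1 := by simp [edgeInd, hxy]
  have evx : edgeInd v x x y = 0 := by simp [edgeInd, hvx.symm, hvy.symm]
  have evy : edgeInd v y x y = 0 := by simp [edgeInd, hvx.symm, hxy]
  have b := h.abs_le x hx y hy
  have p := h.parity x hx y hy
  simp only [exy, evx, evy] at b p
  obtain ⟨s, hs, hb, hp⟩ := exists_sign (φ x y) (m x y) (by simpa using b) (by simpa using p)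
    (hm x y)
  have hmain : ∀ a ∈ S, ∀ b ∈ S,
      |φ a b + s * (arcInd x v a b + arcInd v y a b - arcInd x y a b)| ≤ m a b ∧
      2 ∣ m a b - (φ a b + s * (arcInd x v a b + arcInd v y a b - arcInd x y a b)) := by
    intro a ha c hc
    have h1 := h.abs_le a ha c hc
    have h2 := h.parity a ha c hc
    have hanti := h.antisymm
    have evx' : edgeInd v x a c = edgeInd x v a c := by unfold edgeInd; rw [add_comm]
    rw [evx'] at h1 h2
    have hs' : s = 1 ∨ s = -1 := by
      rcases abs_choice s with e | e <;> omega
    rcases edgeInd_eq_one_or hxy a c with ⟨e, f⟩ | ⟨e, ⟨e1, e2, f⟩ | ⟨e1, e2, f⟩⟩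
    · rcases edgeInd_eq_one_or hvx.symm a c with ⟨e', f'⟩ | ⟨e', ⟨e1', e2', f'⟩ | ⟨e1', e2', f'⟩⟩ <;>
      rcases edgeInd_eq_one_or hvy a c with
        ⟨e'', f''⟩ | ⟨e'', ⟨e1'', e2'', f''⟩ | ⟨e1'', e2'', f''⟩⟩ <;>
      rw [e, e', e''] at h1 h2 <;> rw [f, f', f''] <;> rw [_root_.abs_le] at h1 ⊢ <;>
      rcases hs' with rfl | rfl <;> omega
    · subst e1 e2
      have f' : arcInd a v a c = 0 := by simp [arcInd, hvx.symm, hvy.symm]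
      have f'' : arcInd v c a c = 0 := by simp [arcInd, hvx.symm, hxy]
      rw [f, f', f'']
      constructor
      · convert hb using 2; ring
      · convert hp using 1; ring
    · subst e1 e2
      have f' : arcInd c v a c = 0 := by simp [arcInd, hvy.symm, hxy.symm]
      have f'' : arcInd v a a c = 0 := by simp [arcInd, hvy.symm, hvx.symm]
      rw [f, f', f'', hanti a c, hsymm a c]
      constructor
      · rw [← abs_neg]; convert hb using 2; ring
      · rcases hs' with rfl | rfl <;> omega
  refine ⟨fun a b => φ a b + s * (arcInd x v a b + arcInd v y a b - arcInd x y a b), ?_,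
    fun a ha b hb => (hmain a ha b hb).1, fun a ha b hb => (hmain a ha b hb).2, ?_, ?_⟩
  · intro a b
    rw [h.antisymm a b, arcInd_antisymm x v, arcInd_antisymm v y, arcInd_antisymm x y]; ring
  all_goals
    intro a ha
    have e : ∑ b ∈ S, (φ a b + s * (arcInd x v a b + arcInd v y a b - arcInd x y a b))
        = ∑ b ∈ S, φ a b := by
      simp_rw [Finset.sum_add_distrib, ← Finset.mul_sum, Finset.sum_sub_distrib,
        Finset.sum_add_distrib, sum_arcInd hx hv, sum_arcInd hv hy, sum_arcInd hx hy]
      ring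
    rw [e]
  · exact h.congr a ha
  · exact h.bound a ha

end Moves

/-! ### Lifting at the prescribed vertex, and deleting vertices and arcs -/

section Moves

variable {V : Type*} [DecidableEq V] {k : ℤ} {S : Finset V} {m : V → V → ℤ} {w ψ t : V → ℤ} {v₀ : V}

/-- Lifting an edge at the prescribed vertex together with an edge at an exempt vertex. -/
lemma IsAdmissible.liftPrescribed (h : IsAdmissible k S m w ψ t v₀) (hs : HasSlack k S m w t)
    {y : V} {s : ℤ} (hv : v₀ ∈ S) (hy : y ∈ S) (hvy : v₀ ≠ y) (hmy : 0 < m v₀ y)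
    (hs1 : |s| = 1) (hb : |ψ v₀ - s| ≤ w v₀ - 1) :
    IsAdmissible k S (fun a b => m a b + -1 * edgeInd v₀ y a b)
      (fun a => w a + -1 * vertInd v₀ a + 1 * vertInd y a)
      (fun a => ψ a + -s * vertInd v₀ a + s * vertInd y a) t v₀ := by
  have hs' : s = 1 ∨ s = -1 := by rcases abs_choice s with e | e <;> omega
  have hw : ∑ a ∈ S, (w a + -1 * vertInd v₀ a + 1 * vertInd y a) = ∑ a ∈ S, w a := by
    rw [sum_add_vertInd, sum_add_vertInd, if_pos hv, if_pos hy]; ring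
  have hψ : ∑ a ∈ S, (ψ a + -s * vertInd v₀ a + s * vertInd y a) = ∑ a ∈ S, ψ a := by
    rw [sum_add_vertInd, sum_add_vertInd, if_pos hv, if_pos hy]; ring
  refine ⟨?_, ?_, ?_, ?_, ?_, ?_, ?_, ?_, h.zero, ?_⟩
  · intro a b; rw [h.symm a b, edgeInd_comm v₀ y]
  · intro a; rw [h.diag, edgeInd_diag hvy]; rfl
  · intro a b
    have h0 := h.nonneg a b
    have h1 := h.symm v₀ y
    rcases edgeInd_eq_one_or hvy a b with ⟨e, -⟩ | ⟨e, ⟨e1, e2, -⟩ | ⟨e1, e2, -⟩⟩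
    · rw [e]; omega
    · rw [e, e1, e2]; omega
    · rw [e, e1, e2]; omega
  · intro a ha
    have h0 := h.abs_le a ha
    unfold vertInd
    rw [_root_.abs_le] at h0 hb ⊢
    by_cases e : a = v₀
    · subst e; simp only [if_true, if_neg hvy]; rcases hs' with rfl | rfl <;> omega
    · by_cases e' : a = y
      · subst e'; simp only [if_true, if_neg e]; rcases hs' with rfl | rfl <;> omega
      · simp only [if_neg e, if_neg e']; omega
  · intro a ha
    have h0 := h.parity a ha
    unfold vertInd
    rcases hs' with rfl | rfl <;> split_ifs <;> omega
  · intro a ha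
    have := h.target_parity a ha
    rw [Finset.sum_add_distrib, ← Finset.mul_sum, sum_edgeInd, if_pos hv, if_pos hy]
    omega
  · rw [hψ]; exact h.sum_target
  · rw [hψ, hw]; exact h.degree_le
  · intro A hA hne hAS hA0
    rw [cutWeight_add_edge hv hy, cutWeight_add_vert, cutWeight_add_vert]
    have h1 := h.le_cut A hA hne hAS hA0
    -- As for ordinary lifts: the loss is at most two, and a single vertex other than `v₀` loses
    -- nothing.
    by_cases h2 : 2 ≤ A.card
    · have := hs A hA h2 hAS
      split_ifs <;> omega
    · have hva : v₀ ∉ A := fun hva => h2 (two_le_card_of_ne_singleton hva hA0)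
      simp only [hva, false_iff, if_false]
      split_ifs <;> omega

lemma arc_add_bounds {φ : V → V → ℤ} {p q : V} {s : ℤ} (hs : |s| = 1) (hpq : p ≠ q)
    {a b : V} (h1 : |φ a b| ≤ m a b + -1 * edgeInd p q a b)
    (h2 : 2 ∣ m a b + -1 * edgeInd p q a b - φ a b) :
    |φ a b + s * arcInd p q a b| ≤ m a b ∧ 2 ∣ m a b - (φ a b + s * arcInd p q a b) := by
  have hs' : s = 1 ∨ s = -1 := by rcases abs_choice s with e | e <;> omega
  rw [abs_le] at h1 ⊢
  rcases edgeInd_eq_one_or hpq a b with ⟨e, f⟩ | ⟨e, ⟨-, -, f⟩ | ⟨-, -, f⟩⟩ <;>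
    rw [e] at h1 h2 <;> rw [f] <;> rcases hs' with rfl | rfl <;> omega

/-- The prescribed edge at `y` is rerouted through `v`: the edge `vy` takes over its direction, and
the flow continues along the original prescribed edge at `v`. -/
lemma IsBalancedFlow.liftPrescribed {φ : V → V → ℤ} {v y : V} {s : ℤ}
    (hv : v ∈ S) (hy : y ∈ S) (hvy : v ≠ y) (hs : |s| = 1)
    (h : IsBalancedFlow k S (fun a b => m a b + -1 * edgeInd v y a b)
      (fun a => ψ a + -s * vertInd v a + s * vertInd y a) t φ) :
    IsBalancedFlow k S m ψ t (fun a b => φ a b + -s * arcInd v y a b) := by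
  have hs' : |-s| = 1 := by rwa [abs_neg]
  have e : ∀ a, ∑ b ∈ S, (φ a b + -s * arcInd v y a b) + ψ a
      = ∑ b ∈ S, φ a b + (ψ a + -s * vertInd v a + s * vertInd y a) := fun a => by
    rw [Finset.sum_add_distrib, ← Finset.mul_sum, sum_arcInd hv hy]; ring
  refine ⟨?_, fun a ha b hb => (arc_add_bounds hs' hvy (h.abs_le a ha b hb) (h.parity a ha b hb)).1,
    fun a ha b hb => (arc_add_bounds hs' hvy (h.abs_le a ha b hb) (h.parity a ha b hb)).2, ?_, ?_⟩
  · intro a b; rw [h.antisymm a b, arcInd_antisymm v y]; ring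
  · intro a ha; rw [e]; exact h.congr a ha
  · intro a ha; rw [e]; exact h.bound a ha

/-- Removing an exempt vertex with at most one neighbour. -/
lemma IsAdmissible.erase (hk : 0 < k) (h : IsAdmissible k S m w ψ t v₀) (hv : v₀ ∈ S)
    (hw : w v₀ = 0) {x : V} (hx : ∀ u ∈ S, u ≠ x → m v₀ u = 0) :
    IsAdmissible k (S.erase v₀) m w ψ t v₀ := by
  have hψ : ψ v₀ = 0 := by
    have := h.abs_le v₀ hv; rw [hw] at this; exact abs_nonpos_iff.1 this
  have total : ∀ g : V → ℤ, ∑ v ∈ S.erase v₀, g v = ∑ v ∈ S, g v - g v₀ := fun g => by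
    rw [← Finset.add_sum_erase S g hv]; ring
  have hx' : ∀ u ∈ S, u ≠ x → m u v₀ = 0 := fun u hu hux => by rw [h.symm]; exact hx u hu hux
  refine ⟨h.symm, h.diag, h.nonneg, fun v hv => h.abs_le v (Finset.mem_of_mem_erase hv),
    fun v hv => h.parity v (Finset.mem_of_mem_erase hv), ?_, ?_, ?_,
    fun hv => absurd hv (Finset.notMem_erase _ _), ?_⟩
  · intro v hv'
    have hvS := Finset.mem_of_mem_erase hv'
    rw [total]
    have h1 := h.target_parity v hvS
    -- The degree of `v₀` is even, as its target is divisible by `2 * k`, and all its edges go to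
    -- `x`.
    have h2 : 2 ∣ m v v₀ := by
      by_cases e : v = x
      · have h3 := h.target_parity v₀ hv
        rw [Finset.sum_eq_single_of_mem v hvS fun u hu hne => hx u hu (by rwa [← e]), hw,
          h.symm] at h3
        have h4 : 2 ∣ t v₀ := (Dvd.intro k rfl).trans (h.zero hv)
        omega
      · rw [hx' v hvS e]; simp
    omega
  · rw [total, total, hψ]
    obtain ⟨c, hc⟩ := dvd_sub h.sum_target (h.zero hv)
    exact ⟨c, by linarith⟩
  · rw [total, total, hψ, hw, sub_zero, sub_zero]; exact h.degree_le
  · intro A hA hne hAS hA0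
    have hvA : v₀ ∉ A := fun hh => Finset.notMem_erase _ _ (hA hh)
    have hAS' : A ⊆ S := hA.trans (Finset.erase_subset _ _)
    -- If `x ∈ A`, the cut of `A ∪ {v₀}` is used: it avoids the edges `v₀x`, and the target of `v₀`
    -- does not affect the norm.
    by_cases hxA : x ∈ A
    · have h1 := h.le_cut (insert v₀ A) (Finset.insert_subset hv hAS') ⟨v₀, by simp⟩
        (by rintro rfl; exact hAS (Finset.erase_insert hvA).symm)
        (by
          intro e
          obtain ⟨a, ha⟩ := hne
          have : a ∈ ({v₀} : Finset V) := e ▸ Finset.mem_insert_of_mem ha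
          rw [Finset.mem_singleton] at this
          exact hvA (this ▸ ha))
      rw [Finset.sum_insert hvA, modNorm_congr hk (y := ∑ v ∈ A, t v) (by
        simpa using h.zero hv)] at h1
      refine h1.trans_eq ?_
      have e : S \ insert v₀ A = S.erase v₀ \ A := by
        ext b; simp only [Finset.mem_sdiff, Finset.mem_insert, Finset.mem_erase]; tauto
      rw [cutWeight, cutWeight, e, Finset.sum_insert hvA, Finset.sum_insert hvA, hw,
        Finset.sum_eq_zero (s := S.erase v₀ \ A)]
      · ring
      · intro b hb
        rw [Finset.mem_sdiff] at hb
        exact hx b (Finset.mem_of_mem_erase hb.1) (by rintro rfl; exact hb.2 hxA)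
    · refine (h.le_cut A hAS' hne (by rintro rfl; exact hvA hv) hA0).trans_eq ?_
      have e : S \ A = insert v₀ (S.erase v₀ \ A) := by
        ext b; simp only [Finset.mem_sdiff, Finset.mem_insert, Finset.mem_erase]
        by_cases hb : b = v₀ <;> simp [hb, hv, hvA]
      rw [cutWeight, cutWeight, e]
      congr 1
      refine Finset.sum_congr rfl fun a ha => ?_
      rw [Finset.sum_insert (by simp), hx' a (hAS' ha) (by rintro rfl; exact hxA ha), zero_add]

/-- The edges at `v₀` form one class of even multiplicity, so half of them can be oriented each way;
this is net flow zero. -/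
lemma IsBalancedFlow.of_erase {φ : V → V → ℤ} (hk : 0 < k) (h : IsAdmissible k S m w ψ t v₀)
    (hv : v₀ ∈ S) (hw : w v₀ = 0) {x : V} (hx : ∀ u ∈ S, u ≠ x → m v₀ u = 0)
    (hφ : IsBalancedFlow k (S.erase v₀) m ψ t φ) :
    IsBalancedFlow k S m ψ t (fun a b => if a = v₀ ∨ b = v₀ then 0 else φ a b) := by
  have hψ : ψ v₀ = 0 := by
    have := h.abs_le v₀ hv; rw [hw] at this; exact abs_nonpos_iff.1 this
  have hev : ∀ u ∈ S, 2 ∣ m v₀ u := by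
    intro u hu
    by_cases e : u = x
    · have h3 := h.target_parity v₀ hv
      rw [Finset.sum_eq_single_of_mem u hu fun u hu hne => hx u hu (by rwa [← e]), hw] at h3
      have h4 : 2 ∣ t v₀ := (Dvd.intro k rfl).trans (h.zero hv)
      omega
    · rw [hx u hu e]; simp
  have hD0 : ∑ u ∈ S, (if v₀ = v₀ ∨ u = v₀ then 0 else φ v₀ u) = 0 := by simp
  have hD : ∀ v ∈ S, v ≠ v₀ → ∑ u ∈ S, (if v = v₀ ∨ u = v₀ then 0 else φ v u)
      = ∑ u ∈ S.erase v₀, φ v u := by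
    intro v _ hne
    rw [← Finset.add_sum_erase S _ hv]
    simp only [or_true, if_true, zero_add]
    refine Finset.sum_congr rfl fun u hu => ?_
    rw [if_neg (by simp [hne, Finset.ne_of_mem_erase hu])]
  refine ⟨?_, ?_, ?_, ?_, ?_⟩
  · intro u v
    simp only [or_comm (a := v = v₀)]
    split_ifs
    · rfl
    · exact hφ.antisymm u v
  · intro u hu v hv'
    split_ifs with e
    · rw [abs_zero]; exact h.nonneg u v
    · push Not at e
      exact hφ.abs_le u (Finset.mem_erase.2 ⟨e.1, hu⟩) v (Finset.mem_erase.2 ⟨e.2, hv'⟩)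
  · intro u hu v hv'
    split_ifs with e
    · rcases e with rfl | rfl
      · simpa using hev v hv'
      · rw [h.symm]; simpa using hev u hu
    · push Not at e
      exact hφ.parity u (Finset.mem_erase.2 ⟨e.1, hu⟩) v (Finset.mem_erase.2 ⟨e.2, hv'⟩)
  · intro v hv'
    by_cases e : v = v₀
    · rw [e, hD0, hψ]; simpa using h.zero hv
    · rw [hD v hv' e]; exact hφ.congr v (Finset.mem_erase.2 ⟨e, hv'⟩)
  · intro v hv'
    by_cases e : v = v₀
    · rw [e, hD0, hψ]; simp; omega
    · rw [hD v hv' e]; exact hφ.bound v (Finset.mem_erase.2 ⟨e, hv'⟩)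

/-- Orienting an edge `pq` from `p` to `q`, deleting it and adding `j` edges from `q` to the
prescribed vertex. -/
lemma IsAdmissible.removeArc (hk : 0 < k) (h : IsAdmissible k S m w ψ t v₀)
    (hs : HasSlack k S m w t) (h0 : v₀ ∉ S) {p q : V} {j : ℤ} (hj : 0 ≤ j) (hp : p ∈ S)
    (hq : q ∈ S) (hpq : p ≠ q) (hm : 0 < m p q)
    (hdeg : ∑ v ∈ S, w v + j ≤ 2 * k - 2 + modNorm k (∑ v ∈ S, ψ v + j))
    (htp : modNorm k (t p - 1) + 1 ≤ modNorm k (t p))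
    (htq : modNorm k (t q + (1 + j)) + 1 ≤ modNorm k (t q) + j) :
    IsAdmissible k S (fun a b => m a b + -1 * edgeInd p q a b) (fun a => w a + j * vertInd q a)
      (fun a => ψ a + j * vertInd q a)
      (fun a => t a + -1 * vertInd p a + (1 + j) * vertInd q a) v₀ := by
  refine ⟨?_, ?_, ?_, ?_, ?_, ?_, ?_, ?_, fun hv => absurd hv h0, ?_⟩
  · intro a b; rw [h.symm a b, edgeInd_comm p q]
  · intro a; rw [h.diag, edgeInd_diag hpq]; rfl
  · intro a b
    have h0 := h.nonneg a b
    have h1 := h.symm p q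
    rcases edgeInd_eq_one_or hpq a b with ⟨e, -⟩ | ⟨e, ⟨e1, e2, -⟩ | ⟨e1, e2, -⟩⟩
    · rw [e]; omega
    · rw [e, e1, e2]; omega
    · rw [e, e1, e2]; omega
  · intro a ha
    have h0 := h.abs_le a ha
    unfold vertInd
    rw [_root_.abs_le] at h0 ⊢
    split_ifs <;> simp <;> omega
  · intro a ha
    have h0 := h.parity a ha
    convert h0 using 1
    ring
  · intro a ha
    have := h.target_parity a ha
    rw [Finset.sum_add_distrib, ← Finset.mul_sum, sum_edgeInd, if_pos hp, if_pos hq]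
    unfold vertInd
    split_ifs <;> simp <;> omega
  · rw [sum_add_vertInd, sum_add_vertInd, sum_add_vertInd, if_pos hp, if_pos hq]
    convert h.sum_target using 1
    ring
  · rw [sum_add_vertInd, sum_add_vertInd, if_pos hq, mul_one]
    exact hdeg
  · intro A hA hne hAS hA0
    rw [cutWeight_add_edge hp hq, cutWeight_add_vert, sum_add_vertInd, sum_add_vertInd]
    have h1 := h.le_cut A hA hne hAS hA0
    -- When `A` separates `p` from `q`, the lost edge and a target change of one use up the slack of
    -- two; the `j` new edges at `q` pay for the other `j` units of target change. For single
    -- vertices there is no slack, which is why `htp` and `htq` are needed.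
    by_cases h2 : 2 ≤ A.card
    · have h3 := hs A hA h2 hAS
      by_cases hpA : p ∈ A <;> by_cases hqA : q ∈ A <;>
        simp only [hpA, hqA, if_true, if_false, iff_self, iff_true, iff_false, not_true,
          mul_one, mul_zero, add_zero]
      · have := modNorm_add_le_abs hk (∑ v ∈ A, t v) j
        rw [abs_of_nonneg hj] at this
        rw [show ∑ v ∈ A, t v + -1 + (1 + j) = ∑ v ∈ A, t v + j by ring]
        omega
      · have := modNorm_add_le_abs hk (∑ v ∈ A, t v) (-1)
        simp only [abs_neg, abs_one] at this
        omega
      · have := modNorm_add_le_abs hk (∑ v ∈ A, t v) (1 + j)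
        rw [abs_of_nonneg (by omega)] at this
        omega
      · omega
    · have hc : A.card = 1 := by
        have := hne.card_pos; omega
      obtain ⟨a, rfl⟩ := Finset.card_eq_one.1 hc
      simp only [Finset.sum_singleton, Finset.mem_singleton] at h1 ⊢
      by_cases hpa : p = a
      · subst hpa
        have hqp : ¬ q = p := fun e => hpq e.symm
        simp only [hqp, if_true, if_false, iff_false, not_true, mul_one, mul_zero, add_zero]
        rw [← sub_eq_add_neg]
        omega
      · by_cases hqa : q = a
        · subst hqa
          simp only [hpq, if_true, if_false, false_iff, not_true, mul_one, mul_zero, add_zero]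
          omega
        · simp only [hpa, hqa, if_true, if_false, mul_zero, add_zero]
          exact h1

/-- Restoring the arc raises the net degree of `p` by one, while restoring it and dropping the `j`
extra edges lowers that of `q` by `1 + j`. Only at these two vertices must the bound be checked
again, through `hbp` and `hbq`. -/
lemma IsBalancedFlow.of_removeArc {φ : V → V → ℤ} {p q : V} {j : ℤ} (hp : p ∈ S) (hq : q ∈ S)
    (hpq : p ≠ q)
    (hbp : ∀ D, 2 * k ∣ D - (t p - 1) → |D| ≤ 2 * k - 1 → |D + 1| ≤ 2 * k - 1)
    (hbq : ∀ D, 2 * k ∣ D - (t q + (1 + j)) → |D| ≤ 2 * k - 1 → |D - (1 + j)| ≤ 2 * k - 1)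
    (h : IsBalancedFlow k S (fun a b => m a b + -1 * edgeInd p q a b)
      (fun a => ψ a + j * vertInd q a)
      (fun a => t a + -1 * vertInd p a + (1 + j) * vertInd q a) φ) :
    IsBalancedFlow k S m ψ t (fun a b => φ a b + 1 * arcInd p q a b) := by
  have e : ∀ a, ∑ b ∈ S, (φ a b + 1 * arcInd p q a b) + ψ a
      = ∑ b ∈ S, φ a b + (ψ a + j * vertInd q a) + vertInd p a - (1 + j) * vertInd q a := fun a => by
    rw [Finset.sum_add_distrib, ← Finset.mul_sum, sum_arcInd hp hq]; ring
  have h1 : |(1 : ℤ)| = 1 := abs_one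
  refine ⟨?_, fun a ha b hb => (arc_add_bounds h1 hpq (h.abs_le a ha b hb) (h.parity a ha b hb)).1,
    fun a ha b hb => (arc_add_bounds h1 hpq (h.abs_le a ha b hb) (h.parity a ha b hb)).2, ?_, ?_⟩
  · intro a b; rw [h.antisymm a b, arcInd_antisymm p q]; ring
  · intro a ha; rw [e]; convert h.congr a ha using 1; ring
  · intro a ha
    rw [e]
    have hb := h.bound a ha
    have hc := h.congr a ha
    unfold vertInd at hb hc ⊢
    by_cases hap : a = p
    · subst hap
      simp only [hpq, if_true, if_false, mul_one, mul_zero, add_zero, sub_zero] at hb hc ⊢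
      exact hbp _ hc hb
    · by_cases haq : a = q
      · subst haq
        simp only [hap, if_true, if_false, mul_one, mul_zero, add_zero] at hb hc ⊢
        exact hbq _ hc hb
      · simp only [hap, haq, if_false, mul_zero, add_zero, sub_zero] at hb ⊢
        exact hb

/-- Deleting an edge oriented from `v` to the prescribed vertex. -/
lemma IsAdmissible.removePrescribed (hk : 0 < k) (h : IsAdmissible k S m w ψ t v₀)
    (hs : HasSlack k S m w t) (h0 : v₀ ∉ S) {v : V} (hv : v ∈ S) (hb : |ψ v - 1| ≤ w v - 1)
    (ht : modNorm k (t v - 1) + 1 ≤ modNorm k (t v)) :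
    IsAdmissible k S m (fun a => w a + -1 * vertInd v a) (fun a => ψ a + -1 * vertInd v a)
      (fun a => t a + -1 * vertInd v a) v₀ := by
  refine ⟨h.symm, h.diag, h.nonneg, ?_, ?_, ?_, ?_, ?_, fun hv => absurd hv h0, ?_⟩
  · intro a ha
    have h0 := h.abs_le a ha
    unfold vertInd
    rw [_root_.abs_le] at h0 hb ⊢
    split_ifs with e
    · subst e; omega
    · omega
  · intro a ha
    have h0 := h.parity a ha
    omega
  · intro a ha
    have h0 := h.target_parity a ha
    omega
  · rw [sum_add_vertInd, sum_add_vertInd, if_pos hv]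
    convert h.sum_target using 1
    ring
  · rw [sum_add_vertInd, sum_add_vertInd, if_pos hv]
    have h1 := modNorm_add_le_abs hk (∑ v ∈ S, ψ v + -1 * 1) 1
    have h2 := h.degree_le
    rw [abs_one, show ∑ v ∈ S, ψ v + -1 * 1 + 1 = ∑ v ∈ S, ψ v by ring] at h1
    omega
  · intro A hA hne hAS hA0
    rw [cutWeight_add_vert, sum_add_vertInd]
    have h1 := h.le_cut A hA hne hAS hA0
    by_cases hvA : v ∈ A
    · rw [if_pos hvA, mul_one]
      by_cases e : A = {v}
      · subst e
        simp only [Finset.sum_singleton] at h1 ⊢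
        rw [← sub_eq_add_neg]
        omega
      · have h3 := hs A hA (two_le_card_of_ne_singleton hvA e) hAS
        have := modNorm_add_le_abs hk (∑ v ∈ A, t v) (-1)
        simp only [abs_neg, abs_one] at this
        omega
    · rw [if_neg hvA, mul_zero, add_zero, add_zero]; exact h1

lemma IsBalancedFlow.of_removePrescribed {φ : V → V → ℤ} {v : V}
    (hbv : ∀ D, 2 * k ∣ D - (t v - 1) → |D| ≤ 2 * k - 1 → |D + 1| ≤ 2 * k - 1)
    (h : IsBalancedFlow k S m (fun a => ψ a + -1 * vertInd v a)
      (fun a => t a + -1 * vertInd v a) φ) :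
    IsBalancedFlow k S m ψ t φ := by
  refine ⟨h.antisymm, h.abs_le, h.parity, ?_, ?_⟩
  · intro a ha; convert h.congr a ha using 1; ring
  · intro a ha
    have hb := h.bound a ha
    have hc := h.congr a ha
    unfold vertInd at hb hc
    by_cases e : a = v
    · subst e
      simp only [if_true, mul_one] at hb hc
      convert hbv _ hc hb using 2; ring
    · simpa [e] using hb

end Moves

/-! ### The induction for the extension theorem -/

section Extension

variable {V : Type*} [DecidableEq V] {k : ℤ} {S : Finset V} {m : V → V → ℤ} {w ψ t : V → ℤ} {v₀ : V}

/-- For a positive centered target, one outgoing edge moves the target towards zero. The edge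
requirement of the vertex falls with its degree, so the cut condition survives without slack. -/
lemma modNorm_sub_one_add_one_le (hk : 0 < k) {x r : ℤ} (hx : 2 * k ∣ x - r) (h1 : 1 ≤ r)
    (h2 : r ≤ k) : modNorm k (x - 1) + 1 ≤ modNorm k x := by
  have e1 : modNorm k (x - 1) ≤ r - 1 := by
    have := modNorm_le_abs_of_dvd hk (x := x - 1) (y := r - 1) (by simpa using hx)
    rwa [abs_of_nonneg (by omega)] at this
  obtain ⟨s, hs, hs1, hs2, hs3⟩ := exists_centered_rep hk x
  obtain ⟨c, hc⟩ := hx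
  obtain ⟨d, hd⟩ := hs
  have e2 : s - r = 2 * k * (c - d) := by linarith
  have e3 : s = r := by
    have h3 : c - d < 1 := by by_contra! hh; nlinarith
    have h4 : -1 < c - d := by by_contra! hh; nlinarith
    rw [show c - d = 0 by omega] at e2; omega
  rw [hs3, e3, abs_of_nonneg (by omega)]
  omega

lemma modNorm_add_one_add_one_le (hk : 0 < k) {x r : ℤ} (hx : 2 * k ∣ x - r) (h1 : -k ≤ r)
    (h2 : r ≤ -1) : modNorm k (x + 1) + 1 ≤ modNorm k x := by
  have := modNorm_sub_one_add_one_le hk (x := -x) (r := -r)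
    (by obtain ⟨c, hc⟩ := hx; exact ⟨-c, by linarith⟩) (by omega) (by omega)
  rwa [modNorm_neg hk, show -x - 1 = -(x + 1) by ring, modNorm_neg hk] at this

/-- The bound could fail only for `D = 2 * k - 1`, but then `x` would be congruent to `2 * k`, hence
to zero. -/
lemma abs_add_one_le_of_not_dvd {x D : ℤ} (hx : ¬ 2 * k ∣ x) (hD : 2 * k ∣ D - (x - 1))
    (hb : |D| ≤ 2 * k - 1) : |D + 1| ≤ 2 * k - 1 := by
  have h : D ≠ 2 * k - 1 := by
    rintro rfl
    apply hx
    obtain ⟨c, hc⟩ := hD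
    exact ⟨1 - c, by linarith⟩
  rw [abs_le] at hb ⊢
  omega

lemma abs_sub_one_le_of_not_dvd {x D : ℤ} (hx : ¬ 2 * k ∣ x) (hD : 2 * k ∣ D - (x + 1))
    (hb : |D| ≤ 2 * k - 1) : |D - 1| ≤ 2 * k - 1 := by
  have h : D ≠ -(2 * k - 1) := by
    rintro rfl
    apply hx
    obtain ⟨c, hc⟩ := hD
    exact ⟨-1 - c, by linarith⟩
  rw [abs_le] at hb ⊢
  omega

/-- The extension property for all admissible data on `S` with fewer edges inside `S`, or as many
of these and fewer prescribed edges. -/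
def ExtendsBelow (k : ℤ) (S : Finset V) (m : V → V → ℤ) (w : V → ℤ) : Prop :=
  ∀ (m' : V → V → ℤ) (w' ψ' t' : V → ℤ) (v' : V),
    (∑ a ∈ S, ∑ b ∈ S, m' a b < ∑ a ∈ S, ∑ b ∈ S, m a b ∨
      ∑ a ∈ S, ∑ b ∈ S, m' a b = ∑ a ∈ S, ∑ b ∈ S, m a b ∧ ∑ a ∈ S, w' a < ∑ a ∈ S, w a) →
    IsAdmissible k S m' w' ψ' t' v' → ∃ φ, IsBalancedFlow k S m' ψ' t' φ

lemma sum_sum_add_edge {u v : V} (hu : u ∈ S) (hv : v ∈ S) (m : V → V → ℤ) (c : ℤ) :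
    ∑ a ∈ S, ∑ b ∈ S, (m a b + c * edgeInd u v a b) = ∑ a ∈ S, ∑ b ∈ S, m a b + c * 2 := by
  rw [← sum_sum_edgeInd hu hv]
  simp_rw [Finset.sum_add_distrib, ← Finset.mul_sum]

/-- The case of an exempt vertex. -/
lemma IsAdmissible.exists_flow_of_exempt (hk : 2 ≤ k) (h : IsAdmissible k S m w ψ t v₀)
    (hs : HasSlack k S m w t) (hv : v₀ ∈ S) (hcard : 2 ≤ S.card)
    (ih : ExtendsBelow k S m w)
    (ihS : IsAdmissible k (S.erase v₀) m w ψ t v₀ → ∃ φ, IsBalancedFlow k (S.erase v₀) m ψ t φ) :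
    ∃ φ, IsBalancedFlow k S m ψ t φ := by
  have hk0 : 0 < k := by omega
  have hne : ∀ u, 0 < m v₀ u → v₀ ≠ u := by
    rintro u hu rfl; rw [h.diag] at hu; exact lt_irrefl _ hu
  by_cases h2 : ∃ x ∈ S, ∃ y ∈ S, x ≠ y ∧ 0 < m v₀ x ∧ 0 < m v₀ y
  · obtain ⟨x, hx, y, hy, hxy, hmx, hmy⟩ := h2
    refine Exists.elim (ih _ w ψ t v₀ (Or.inl ?_)
      (h.lift hs hv hx hy (hne x hmx) (hne y hmy) hxy hmx hmy)) fun φ hφ => ?_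
    · rw [sum_sum_add_edge hx hy (fun a b => m a b + -1 * edgeInd v₀ x a b + -1 * edgeInd v₀ y a b),
        sum_sum_add_edge hv hy (fun a b => m a b + -1 * edgeInd v₀ x a b), sum_sum_add_edge hv hx]
      omega
    · exact hφ.lift h.nonneg h.symm hv hx hy (hne x hmx) (hne y hmy) hxy
  push Not at h2
  have hw0 := h.weight_nonneg hv
  by_cases h1 : ∃ y ∈ S, 0 < m v₀ y
  · obtain ⟨y, hy, hmy⟩ := h1
    rcases hw0.eq_or_lt with hw | hw
    · have hx : ∀ u ∈ S, u ≠ y → m v₀ u = 0 := fun u hu huy =>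
        le_antisymm (h2 y hy u hu huy.symm hmy) (h.nonneg _ _)
      obtain ⟨φ, hφ⟩ := ihS (h.erase hk0 hv hw.symm hx)
      exact ⟨_, hφ.of_erase hk0 h hv hw.symm hx⟩
    · obtain ⟨s, hs1, hs2, -⟩ := exists_sign (ψ v₀) (w v₀ - 1)
        (by simpa using h.abs_le v₀ hv) (by simpa using h.parity v₀ hv) (by omega)
      refine Exists.elim (ih _ _ _ t v₀ (Or.inl ?_)
        (h.liftPrescribed hs hv hy (hne y hmy) hmy hs1 hs2)) fun φ hφ => ?_
      · rw [sum_sum_add_edge hv hy]; omega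
      · exact ⟨_, hφ.liftPrescribed hv hy (hne y hmy) hs1⟩
  · push Not at h1
    have hx : ∀ u ∈ S, m v₀ u = 0 := fun u hu => le_antisymm (h1 u hu) (h.nonneg _ _)
    -- If `v₀` has no neighbour in `S`, the cut of `S \ {v₀}` consists of the prescribed edges not
    -- at `v₀`. The cut condition and `degree_le` then leave no room for prescribed edges at `v₀`.
    have hw : w v₀ = 0 := by
      have hsub : S \ {v₀} ⊆ S := Finset.sdiff_subset
      have hvS : {v₀} ⊆ S := Finset.singleton_subset_iff.2 hv
      have h3 := h.le_cut (S \ {v₀}) hsub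
        (by
          rw [← Finset.card_pos, Finset.card_sdiff_of_subset hvS, Finset.card_singleton]; omega)
        (fun e => by
          have : v₀ ∈ S \ {v₀} := e.symm ▸ hv
          simp at this)
        (fun e => by
          have : v₀ ∈ S \ {v₀} := e.symm ▸ Finset.mem_singleton_self v₀
          simp at this)
      have h4 : cutWeight m w S (S \ {v₀}) = ∑ a ∈ S \ {v₀}, w a := by
        rw [cutWeight, Finset.sdiff_sdiff_eq_self hvS, Finset.sum_eq_zero, zero_add]
        intro a ha
        rw [Finset.sum_singleton, h.symm]
        exact hx a (hsub ha)
      have e1 := sum_eq_add_sum_sdiff hvS w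
      have e2 := sum_eq_add_sum_sdiff hvS t
      rw [Finset.sum_singleton] at e1 e2
      have h5 : modNorm k (∑ v ∈ S \ {v₀}, t v) = modNorm k (∑ v ∈ S, ψ v) := by
        refine modNorm_congr hk0 ?_
        obtain ⟨c, hc⟩ := dvd_sub h.sum_target (h.zero hv)
        exact ⟨c, by linarith⟩
      have := h.degree_le
      omega
    obtain ⟨φ, hφ⟩ := ihS (h.erase hk0 hv hw (x := v₀) fun u hu _ => hx u hu)
    exact ⟨_, hφ.of_erase hk0 h hv hw (x := v₀) fun u hu _ => hx u hu⟩

/-- Two complementary vertex sets are joined by an edge. -/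
lemma IsAdmissible.exists_edge (hk : 2 ≤ k) (h : IsAdmissible k S m w ψ t v₀) (h0 : v₀ ∉ S)
    {A : Finset V} (hA : A ⊆ S) (hne : A.Nonempty) (hAS : A ≠ S) :
    ∃ p ∈ A, ∃ q ∈ S \ A, 0 < m p q := by
  have hk0 : 0 < k := by omega
  by_contra! hc
  have hz : ∑ a ∈ A, ∑ b ∈ S \ A, m a b ≤ 0 :=
    Finset.sum_nonpos fun a ha => Finset.sum_nonpos fun b hb => hc a ha b hb
  have hne' : (S \ A).Nonempty := Finset.sdiff_nonempty.2 fun hh => hAS (hA.antisymm hh)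
  have notv : ∀ B ⊆ S, B ≠ {v₀} := fun B hB e => h0 (hB (e ▸ Finset.mem_singleton_self v₀))
  have h1 := h.le_cut A hA hne hAS (notv A hA)
  have h2 := h.le_cut (S \ A) Finset.sdiff_subset hne'
    (fun e => by
      obtain ⟨a, ha⟩ := hne
      have : a ∈ S \ A := e.symm ▸ hA ha
      exact (Finset.mem_sdiff.1 this).2 ha) (notv _ Finset.sdiff_subset)
  have h3 := cutWeight_add_compl h.symm (w := w) hA
  -- By subadditivity both cuts together have at least `4 * k - 4` edges plus the norm of the total,
  -- whereas prescribed edges account for at most `2 * k - 2` plus that norm. For `k ≥ 2` some edge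
  -- must join the two sides.
  have h4 := modNorm_add_le hk0 (∑ v ∈ A, t v) (∑ v ∈ S \ A, t v)
  rw [← sum_eq_add_sum_sdiff hA, modNorm_congr hk0 h.sum_target] at h4
  have := h.degree_le
  omega

/-- The case of positive targets. -/
lemma IsAdmissible.exists_flow_of_pos (hk : 2 ≤ k) (h : IsAdmissible k S m w ψ t v₀)
    (hs : HasSlack k S m w t) (h0 : v₀ ∉ S) (hcard : 2 ≤ S.card) (ih : ExtendsBelow k S m w)
    (hpos : ∀ v ∈ S, ∃ r, 2 * k ∣ t v - r ∧ 1 ≤ r ∧ r ≤ k) :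
    ∃ φ, IsBalancedFlow k S m ψ t φ := by
  have hk0 : 0 < k := by omega
  have hnd : ∀ v ∈ S, ¬ 2 * k ∣ t v := by
    intro v hv hd
    obtain ⟨r, hr, h1, h2⟩ := hpos v hv
    have := Int.le_of_dvd (by omega) ((dvd_sub_right hd).1 hr)
    omega
  -- If `ψ v ≠ -w v`, some prescribed edge leaves `v`; deleting it lowers the positive target by
  -- one.
  by_cases hψ : ∃ v ∈ S, ψ v ≠ -w v
  · obtain ⟨v, hv, hne⟩ := hψ
    obtain ⟨r, hr, h1, h2⟩ := hpos v hv
    have hb := h.abs_le v hv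
    have hp := h.parity v hv
    rw [_root_.abs_le] at hb
    refine Exists.elim (ih m _ _ _ v₀ (Or.inr ⟨rfl, ?_⟩)
      (h.removePrescribed hk0 hs h0 hv (by rw [_root_.abs_le]; omega)
        (modNorm_sub_one_add_one_le hk0 hr h1 h2))) fun φ hφ => ?_
    · rw [sum_add_vertInd, if_pos hv]; omega
    · exact ⟨φ, hφ.of_removePrescribed fun D => abs_add_one_le_of_not_dvd (hnd v hv)⟩
  push Not at hψ
  -- All prescribed edges now enter `S`. An arc from `p` to `q` helps `p` but moves the target of
  -- `q` away from zero. With `s` the representative at `q`, adding `k - s` edges from `q` to the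
  -- prescribed vertex pushes that target past `k`, to `k + 1`, whose norm is `k - 1`.
  obtain ⟨p, hp⟩ : S.Nonempty := Finset.card_pos.1 (by omega)
  obtain ⟨p', hp', q, hq, hm⟩ := h.exists_edge hk h0 (Finset.singleton_subset_iff.2 hp)
    (Finset.singleton_nonempty p) (by rintro e; rw [← e] at hcard; simp at hcard)
  rw [Finset.mem_singleton] at hp'
  subst hp'
  rw [Finset.mem_sdiff, Finset.mem_singleton] at hq
  obtain ⟨hq, hqp⟩ := hq
  obtain ⟨r, hr, hr1, hr2⟩ := hpos p' hp
  obtain ⟨s, hsq, hs1, hs2⟩ := hpos q hq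
  have hψw : ∑ v ∈ S, ψ v = -∑ v ∈ S, w v := by
    rw [← Finset.sum_neg_distrib]; exact Finset.sum_congr rfl hψ
  have hW0 : 0 ≤ ∑ v ∈ S, w v := Finset.sum_nonneg fun v hv => h.weight_nonneg hv
  have hdeg := h.degree_le
  rw [hψw, modNorm_neg hk0] at hdeg
  have hW := abs_lt_of_le_modNorm hk0 (D := ∑ v ∈ S, w v) (by rwa [abs_of_nonneg hW0])
  rw [abs_of_nonneg hW0] at hW
  have hq1 : modNorm k (t q + (1 + (k - s))) ≤ k - 1 := by
    have := modNorm_le_abs_of_dvd hk0 (x := t q + (1 + (k - s))) (y := 1 - k) (by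
      obtain ⟨c, hc⟩ := hsq; exact ⟨c + 1, by linarith⟩)
    rw [abs_of_nonpos (by omega)] at this
    omega
  have hq2 : s ≤ modNorm k (t q) := by
    have h1 := modNorm_sub_one_add_one_le hk0 hsq hs1 hs2
    have h2 := modNorm_nonneg hk0 (t q - 1)
    obtain ⟨s', hs', hs1', hs2', hs3'⟩ := exists_centered_rep hk0 (t q)
    obtain ⟨c, hc⟩ := hsq
    obtain ⟨d, hd⟩ := hs'
    have e2 : s' - s = 2 * k * (c - d) := by linarith
    have h3 : c - d < 1 := by by_contra! hh; nlinarith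
    have h4 : -1 < c - d := by by_contra! hh; nlinarith
    rw [show c - d = 0 by omega] at e2
    have := le_abs_self s'
    omega
  -- The new edges run against the old prescribed ones. Here `c` is the number of periods between
  -- `-W + (k - s)` and its centered representative; `c = 0` uses `s ≥ 1` and `c = -1` uses `W ≤ 2 *
  -- k - 1`.
  have hdeg' : ∑ v ∈ S, w v + (k - s) ≤ 2 * k - 2 + modNorm k (∑ v ∈ S, ψ v + (k - s)) := by
    rw [hψw]
    generalize ∑ v ∈ S, w v = W at *
    obtain ⟨x, ⟨c, hc⟩, hx1, hx2, hx3⟩ := exists_centered_rep hk0 (-W + (k - s))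
    rw [hx3]
    have h3 : c < 1 := by by_contra! hh; nlinarith
    have h4 : -2 < c := by by_contra! hh; nlinarith
    have h5 := le_abs_self x
    have h6 := neg_le_abs x
    rcases (by omega : c = 0 ∨ c = -1) with rfl | rfl
    · omega
    · omega
  refine Exists.elim (ih _ _ _ _ v₀ (Or.inl ?_)
    (h.removeArc hk0 hs h0 (j := k - s) (by omega) hp hq (Ne.symm hqp) hm hdeg'
      (modNorm_sub_one_add_one_le hk0 hr hr1 hr2) (by omega))) fun φ hφ => ?_
  · rw [sum_sum_add_edge hp hq]; omega
  · refine ⟨_, hφ.of_removeArc hp hq (Ne.symm hqp)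
      (fun D => abs_add_one_le_of_not_dvd (hnd p' hp)) ?_⟩
    intro D hD hb
    obtain ⟨c, hc⟩ := hsq
    obtain ⟨d, hd⟩ := hD
    rw [_root_.abs_le] at hb ⊢
    have e : D - (k + 1) = 2 * k * (c + d) := by linarith
    have h3 : c + d < 1 := by by_contra! hh; nlinarith
    have h4 : -2 < c + d := by by_contra! hh; nlinarith
    -- The net degree `D` is `k + 1` or `1 - k`; subtracting `1 + (k - s)` gives `s` or `s - 2 * k`.
    rcases (by omega : c + d = 0 ∨ c + d = -1) with e' | e' <;> rw [e'] at e <;> omega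

/-- The case without targets divisible by `2 * k`. -/
lemma IsAdmissible.exists_flow_of_ne_zero (hk : 2 ≤ k) (h : IsAdmissible k S m w ψ t v₀)
    (hs : HasSlack k S m w t) (hcard : 2 ≤ S.card) (ih : ExtendsBelow k S m w)
    (hnd : ∀ v ∈ S, ¬ 2 * k ∣ t v) :
    ∃ φ, IsBalancedFlow k S m ψ t φ := by
  have hk0 : 0 < k := by omega
  have h0 : v₀ ∉ S := fun hv => hnd v₀ hv (h.zero hv)
  choose r hr hr1 hr2 _ using fun v => exists_centered_rep hk0 (t v)
  have hr0 : ∀ v ∈ S, r v ≠ 0 := by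
    intro v hv e
    have := hr v
    rw [e, sub_zero] at this
    exact hnd v hv this
  -- An arc from a positive to a negative target lowers both norms, so no extra edges are needed.
  by_cases hedge : ∃ p ∈ S, ∃ q ∈ S, 0 < r p ∧ r q < 0 ∧ 0 < m p q
  · obtain ⟨p, hp, q, hq, hrp, hrq, hm⟩ := hedge
    have hpq : p ≠ q := by rintro rfl; omega
    have htq := modNorm_add_one_add_one_le hk0 (hr q) (by have := hr1 q; omega) (by omega)
    refine Exists.elim (ih _ _ _ _ v₀ (Or.inl ?_)
      (h.removeArc hk0 hs h0 (j := 0) le_rfl hp hq hpq hm (by simpa using h.degree_le)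
        (modNorm_sub_one_add_one_le hk0 (hr p) (by omega) (hr2 p)) (by simpa using htq))) fun φ hφ => ?_
    · rw [sum_sum_add_edge hp hq]; omega
    · exact ⟨_, hφ.of_removeArc hp hq hpq (fun D => abs_add_one_le_of_not_dvd (hnd p hp))
        (by simpa using fun D => abs_sub_one_le_of_not_dvd (hnd q hq))⟩
  push Not at hedge
  by_cases hall : ∀ v ∈ S, 0 < r v
  · exact h.exists_flow_of_pos hk hs h0 hcard ih fun v hv =>
      ⟨r v, hr v, by have := hall v hv; omega, hr2 v⟩
  by_cases hall' : ∀ v ∈ S, r v < 0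
  · have hsn : HasSlack k S m w (fun v => -t v) := by
      intro A hA h2 hAS
      rw [Finset.sum_neg_distrib, modNorm_neg hk0]
      exact hs A hA h2 hAS
    obtain ⟨φ, hφ⟩ := (h.neg hk0).exists_flow_of_pos hk hsn h0 hcard ih fun v hv =>
      ⟨-r v, by obtain ⟨c, hc⟩ := hr v; exact ⟨-c, by linarith⟩, by have := hall' v hv; omega,
        by have := hr1 v; omega⟩
    exact ⟨_, hφ.neg⟩
  push Not at hall hall'
  obtain ⟨n, hn, hrn⟩ := hall
  obtain ⟨p, hp, hrp⟩ := hall'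
  obtain ⟨a, ha, b, hb, hm⟩ := h.exists_edge hk h0 (A := S.filter fun v => 0 < r v)
    (Finset.filter_subset _ _) ⟨p, Finset.mem_filter.2 ⟨hp, by have := hr0 p hp; omega⟩⟩
    (fun e => by
      have : n ∈ S.filter fun v => 0 < r v := e.symm ▸ hn
      have := (Finset.mem_filter.1 this).2
      omega)
  rw [Finset.mem_filter] at ha
  rw [Finset.mem_sdiff, Finset.mem_filter] at hb
  have hrb : r b < 0 := by
    have := hr0 b hb.1
    have : ¬ 0 < r b := fun hh => hb.2 ⟨hb.1, hh⟩
    omega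
  exact absurd hm (not_lt.2 (hedge a ha.1 b hb.1 ha.2 hrb))

/-- Nothing is left to orient: the congruence is `sum_target`, and the bound comes from `degree_le`
through `abs_lt_of_le_modNorm`. -/
lemma IsAdmissible.exists_flow_of_card_le_one (hk : 0 < k) (h : IsAdmissible k S m w ψ t v₀)
    (hcard : S.card ≤ 1) : ∃ φ, IsBalancedFlow k S m ψ t φ := by
  refine ⟨fun _ _ => 0, by simp, fun u _ v _ => by simpa using h.nonneg u v, ?_, ?_, ?_⟩
  · intro u hu v hv
    rw [Finset.card_le_one.1 hcard u hu v hv, h.diag]; simp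
  all_goals
    intro v hv
    obtain rfl : S = {v} := Finset.eq_singleton_iff_unique_mem.2
      ⟨hv, fun u hu => Finset.card_le_one.1 hcard u hu v hv⟩
    have h1 := h.sum_target
    have h2 := h.degree_le
    have h3 := h.abs_le v hv
    simp only [Finset.sum_singleton, zero_add] at h1 h2 ⊢
  · rw [← neg_sub]; exact h1.neg_right
  · exact abs_lt_of_le_modNorm hk (h3.trans h2)

/-- The extension theorem for orientations modulo `2 * k` with one prescribed vertex. -/
theorem IsAdmissible.exists_flow (hk : 2 ≤ k) (h : IsAdmissible k S m w ψ t v₀) :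
    ∃ φ, IsBalancedFlow k S m ψ t φ := by
  have hk0 : 0 < k := by omega
  -- The induction is lexicographic in the number of vertices, the edges inside `S` and the
  -- prescribed edges, because deleting an inner arc may create prescribed edges.
  obtain ⟨n, hn⟩ : ∃ n, n = S.card := ⟨_, rfl⟩
  induction n using Nat.strong_induction_on generalizing S m w ψ t v₀ with
  | _ n ihn =>
  obtain ⟨M, hM⟩ : ∃ M : ℕ, (M : ℤ) = ∑ a ∈ S, ∑ b ∈ S, m a b :=
    ⟨_, Int.toNat_of_nonneg (Finset.sum_nonneg fun a _ => Finset.sum_nonneg fun b _ => h.nonneg a b)⟩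
  induction M using Nat.strong_induction_on generalizing m w ψ t v₀ with
  | _ M ihM =>
  obtain ⟨W, hW⟩ : ∃ W : ℕ, (W : ℤ) = ∑ a ∈ S, w a :=
    ⟨_, Int.toNat_of_nonneg (Finset.sum_nonneg fun a ha => h.weight_nonneg ha)⟩
  induction W using Nat.strong_induction_on generalizing m w ψ t v₀ with
  | _ W ihW =>
  have ih : ExtendsBelow k S m w := by
    intro m' w' ψ' t' v' hlt h'
    rcases hlt with hlt | ⟨heq, hlt⟩
    · have hnn : 0 ≤ ∑ a ∈ S, ∑ b ∈ S, m' a b :=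
        Finset.sum_nonneg fun a _ => Finset.sum_nonneg fun b _ => h'.nonneg a b
      exact ihM (∑ a ∈ S, ∑ b ∈ S, m' a b).toNat (by omega) h' (Int.toNat_of_nonneg hnn)
    · have hnn : 0 ≤ ∑ a ∈ S, w' a := Finset.sum_nonneg fun a ha => h'.weight_nonneg ha
      exact ihW (∑ a ∈ S, w' a).toNat (by omega) h' (hM.trans heq.symm) (Int.toNat_of_nonneg hnn)
  rcases Nat.lt_or_ge 1 S.card with hcard | hcard
  swap
  · exact h.exists_flow_of_card_le_one hk0 hcard
  by_cases htight : ∃ A ⊆ S, 2 ≤ A.card ∧ A ≠ S ∧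
      cutWeight m w S A ≤ 2 * k - 2 + modNorm k (∑ v ∈ A, t v)
  · obtain ⟨A, hA, h2, hAS, hle⟩ := htight
    exact h.exists_flow_of_tight hk0 hA h2 hAS hle fun S' m' w' ψ' t' hlt h' =>
      ihn S'.card (hn ▸ hlt) h' rfl
  push Not at htight
  have hs : HasSlack k S m w t := fun A hA h2 hAS =>
    h.add_two_le_cut hk0 hA (htight A hA h2 hAS)
  by_cases hz : ∃ v ∈ S, 2 * k ∣ t v
  · obtain ⟨v, hv, hzv, h'⟩ : ∃ v ∈ S, 2 * k ∣ t v ∧ IsAdmissible k S m w ψ t v := by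
      by_cases hv₀ : v₀ ∈ S
      · exact ⟨v₀, hv₀, h.zero hv₀, h⟩
      -- With `v₀` outside `S` no cut is exempt, so the exemption may be handed to any vertex of
      -- target zero.
      · obtain ⟨v, hv, hzv⟩ := hz
        refine ⟨v, hv, hzv, { h with zero := fun _ => hzv, le_cut := ?_ }⟩
        intro A hA hne hAS _
        exact h.le_cut A hA hne hAS fun e => hv₀ (hA (e ▸ Finset.mem_singleton_self v₀))
    refine h'.exists_flow_of_exempt hk hs hv hcard ih fun he => ?_
    exact ihn (S.erase v).card (hn ▸ Finset.card_erase_lt_of_mem hv) he rfl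
  · push Not at hz
    exact h.exists_flow_of_ne_zero hk hs hcard ih hz

end Extension

/-! ### Signed edges

A family of edges with ends `a i`, `b i` is divided into the edges `N`, whose two ends receive
opposite signs, and the edges `P`, whose two ends receive the same sign. -/

section Signed

variable {V ι : Type*} [DecidableEq V]

/-- The sum of the signs received by `v`. -/
def netDegree (N P : Finset ι) (a b : ι → V) (s : ι → ℤ) (v : V) : ℤ :=
  ∑ i ∈ N, s i * (vertInd (a i) v - vertInd (b i) v) +
    ∑ i ∈ P, s i * (vertInd (a i) v + vertInd (b i) v)

/-- The number of edges at `v`, loops counted twice. -/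
def incidences (Q : Finset ι) (a b : ι → V) (v : V) : ℤ :=
  ∑ i ∈ Q, (vertInd (a i) v + vertInd (b i) v)

/-- The hypotheses under which signs with net degrees congruent to `T` modulo `2 * k` exist. -/
structure IsSignable (k : ℤ) (S : Finset V) (N P : Finset ι) (a b : ι → V) (T : V → ℤ) :
    Prop where
  disj : Disjoint N P
  memN : ∀ i ∈ N, a i ∈ S ∧ b i ∈ S
  memP : ∀ i ∈ P, a i ∈ S ∧ b i ∈ S
  parity : ∀ v ∈ S, 2 ∣ incidences N a b v + incidences P a b v - T v
  conn : ∀ A ⊆ S, A.Nonempty → A ≠ S →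
    3 * k - 3 ≤ ∑ i ∈ N, if (a i ∈ A ↔ b i ∈ A) then (0 : ℤ) else 1
  total : ∃ x : ℤ, 0 ≤ x ∧ x ≤ P.card ∧ 2 * k ∣ ∑ v ∈ S, T v - 2 * (2 * x - P.card)

lemma vertInd_nonneg (u v : V) : 0 ≤ vertInd u v := by unfold vertInd; split_ifs <;> simp

lemma sum_sum_vertInd {S : Finset V} {Q : Finset ι} {a b : ι → V}
    (h : ∀ i ∈ Q, a i ∈ S ∧ b i ∈ S) (s : ι → ℤ) :
    ∑ v ∈ S, ∑ i ∈ Q, s i * (vertInd (a i) v + vertInd (b i) v) = 2 * ∑ i ∈ Q, s i := by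
  rw [Finset.sum_comm, Finset.mul_sum]
  refine Finset.sum_congr rfl fun i hi => ?_
  rw [← Finset.mul_sum, Finset.sum_add_distrib, sum_vertInd, sum_vertInd, if_pos (h i hi).1,
    if_pos (h i hi).2]
  ring

variable [DecidableEq ι]

/-- A flow bounded by the multiplicities of a family of edges comes from signs of these edges. -/
lemma exists_signs_of_flow {S : Finset V} (N : Finset ι) {a b : ι → V}
    (hN : ∀ i ∈ N, a i ∈ S ∧ b i ∈ S ∧ a i ≠ b i) (φ : V → V → ℤ)
    (hanti : ∀ u v, φ u v = -φ v u)
    (hle : ∀ u ∈ S, ∀ v ∈ S, |φ u v| ≤ ∑ i ∈ N, edgeInd (a i) (b i) u v)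
    (hpar : ∀ u ∈ S, ∀ v ∈ S, 2 ∣ ∑ i ∈ N, edgeInd (a i) (b i) u v - φ u v) :
    ∃ s : ι → ℤ, (∀ i, |s i| = 1) ∧ ∀ v ∈ S,
      ∑ i ∈ N, s i * (vertInd (a i) v - vertInd (b i) v) = ∑ u ∈ S, φ v u := by
  induction N using Finset.induction_on generalizing φ with
  | empty =>
    refine ⟨fun _ => 1, by simp, fun v hv => ?_⟩
    rw [Finset.sum_empty, Finset.sum_eq_zero]
    intro u hu
    simpa using hle v hv u hu
  | insert i N hi ih =>
    obtain ⟨ha, hb, hab⟩ := hN i (Finset.mem_insert_self i N)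
    simp only [Finset.sum_insert hi] at hle hpar
    have hii : edgeInd (a i) (b i) (a i) (b i) = 1 := by simp [edgeInd, hab]
    have h1 := hle _ ha _ hb
    have h2 := hpar _ ha _ hb
    rw [hii, add_comm] at h1 h2
    obtain ⟨s₀, hs₀, hb1, hb2⟩ := exists_sign _ _ h1 h2
      (Finset.sum_nonneg fun j _ => edgeInd_nonneg _ _ _ _)
    have hsym : ∑ j ∈ N, edgeInd (a j) (b j) (b i) (a i) = ∑ j ∈ N, edgeInd (a j) (b j) (a i) (b i) :=
      Finset.sum_congr rfl fun j _ => edgeInd_comm _ _ _ _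
    have key : ∀ u ∈ S, ∀ v ∈ S,
        |φ u v + -s₀ * arcInd (a i) (b i) u v| ≤ ∑ j ∈ N, edgeInd (a j) (b j) u v ∧
        2 ∣ ∑ j ∈ N, edgeInd (a j) (b j) u v - (φ u v + -s₀ * arcInd (a i) (b i) u v) := by
      intro u hu v hv
      have h3 := hle u hu v hv
      have h4 := hpar u hu v hv
      rcases edgeInd_eq_one_or hab u v with ⟨e, f⟩ | ⟨e, ⟨e1, e2, f⟩ | ⟨e1, e2, f⟩⟩
      · rw [e, zero_add] at h3 h4
        rw [f, mul_zero, add_zero]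
        exact ⟨h3, h4⟩
      · rw [f, e1, e2, mul_one, ← sub_eq_add_neg]
        exact ⟨hb1, hb2⟩
      · rw [f, e1, e2, hsym, hanti]
        constructor
        · rw [← abs_neg]; convert hb1 using 2; ring
        · have hs' : s₀ = 1 ∨ s₀ = -1 := by rcases abs_choice s₀ with e | e <;> omega
          rcases hs' with rfl | rfl <;> omega
    obtain ⟨s, hs, hsum⟩ := ih (fun j hj => hN j (Finset.mem_insert_of_mem hj))
      (fun u v => φ u v + -s₀ * arcInd (a i) (b i) u v)
      (fun u v => by rw [hanti u v, arcInd_antisymm]; ring)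
      (fun u hu v hv => (key u hu v hv).1) (fun u hu v hv => (key u hu v hv).2)
    refine ⟨Function.update s i s₀, ?_, ?_⟩
    · intro j
      by_cases e : j = i
      · rw [e, Function.update_self]; exact hs₀
      · rw [Function.update_of_ne e]; exact hs j
    · intro v hv
      rw [Finset.sum_insert hi, Function.update_self]
      have e : ∑ j ∈ N, Function.update s i s₀ j * (vertInd (a j) v - vertInd (b j) v)
          = ∑ j ∈ N, s j * (vertInd (a j) v - vertInd (b j) v) :=
        Finset.sum_congr rfl fun j hj => by
          rw [Function.update_of_ne (by rintro rfl; exact hi hj)]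
      rw [e, hsum v hv, Finset.sum_add_distrib, ← Finset.mul_sum, sum_arcInd ha hb]
      ring

lemma exists_signs_sum_eq (P : Finset ι) {x : ℤ} (h0 : 0 ≤ x) (h1 : x ≤ P.card) :
    ∃ s : ι → ℤ, (∀ i, |s i| = 1) ∧ ∑ i ∈ P, s i = 2 * x - P.card := by
  obtain ⟨Q, hQ, hc⟩ := Finset.exists_subset_card_eq (s := P) (n := x.toNat) (by omega)
  refine ⟨fun i => if i ∈ Q then 1 else -1, fun i => by dsimp only; split_ifs <;> simp, ?_⟩
  rw [← Finset.sum_sdiff hQ, Finset.sum_congr (s₁ := Q) (g := fun _ => (1 : ℤ)) rfl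
      (fun i hi => if_pos hi), Finset.sum_congr (s₁ := P \ Q) (g := fun _ => (-1 : ℤ)) rfl
      (fun i hi => if_neg (Finset.mem_sdiff.1 hi).2)]
  have := Finset.card_le_card hQ
  simp only [Finset.sum_const, Finset.card_sdiff_of_subset hQ, nsmul_eq_mul]
  push_cast [this]
  omega

variable {k : ℤ} {S : Finset V} {N P : Finset ι} {a b : ι → V} {T : V → ℤ}

/-- With few edges in `P`, their signs can be fixed in advance. -/
lemma IsSignable.exists_signs_of_card_lt (hk : 2 ≤ k) (h : IsSignable k S N P a b T) {o : V}
    (ho : o ∉ S) (hP : (P.card : ℤ) ≤ k - 1) :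
    ∃ s : ι → ℤ, (∀ i, |s i| = 1) ∧ ∀ v ∈ S, 2 * k ∣ netDegree N P a b s v - T v ∧
      |netDegree N P a b s v| ≤ 2 * k - 1 := by
  have hk0 : 0 < k := by omega
  obtain ⟨x, hx0, hx1, hx⟩ := h.total
  obtain ⟨s₁, hs₁, hsum⟩ := exists_signs_sum_eq P hx0 hx1
  have hs₁' : ∀ i, s₁ i = 1 ∨ s₁ i = -1 := fun i => by
    have := hs₁ i
    rcases abs_choice (s₁ i) with e | e <;> omega
  -- Loops, which merging may create in `N`, add nothing to net degrees and an even number to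
  -- incidences; they are left out.
  set N' := N.filter fun i => a i ≠ b i with hN'
  have hmem : ∀ i ∈ N', a i ∈ S ∧ b i ∈ S ∧ a i ≠ b i := fun i hi => by
    rw [hN', Finset.mem_filter] at hi
    exact ⟨(h.memN i hi.1).1, (h.memN i hi.1).2, hi.2⟩
  let m : V → V → ℤ := fun u v => ∑ i ∈ N', edgeInd (a i) (b i) u v
  -- Each edge of `P` becomes two edges from its ends to the prescribed vertex, both leaving their
  -- ends if its sign is `1` and both entering them otherwise.
  let ψ : V → ℤ := fun v => ∑ i ∈ P, s₁ i * (vertInd (a i) v + vertInd (b i) v)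
  have hsymm : ∀ u v, m u v = m v u := fun u v =>
    Finset.sum_congr rfl fun i _ => edgeInd_comm _ _ _ _
  have hdiag : ∀ v, m v v = 0 := fun v =>
    Finset.sum_eq_zero fun i hi => edgeInd_diag (hmem i hi).2.2 v
  have hdeg : ∀ v, ∑ u ∈ S, m v u = incidences N' a b v := fun v => by
    simp only [m]
    rw [Finset.sum_comm, incidences]
    refine Finset.sum_congr rfl fun i hi => ?_
    rw [sum_edgeInd, if_pos (hmem i hi).1, if_pos (hmem i hi).2.1]
  have hloop : ∀ v, 2 ∣ incidences N a b v - incidences N' a b v := fun v => by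
    rw [incidences, incidences, hN', Finset.sum_filter, ← Finset.sum_sub_distrib]
    refine Finset.dvd_sum fun i _ => ?_
    by_cases e : a i = b i
    · simp only [e, ne_eq, not_true, if_false]; omega
    · simp [e]
  have hpar : ∀ v ∈ S, 2 ∣ ∑ u ∈ S, m v u + incidences P a b v - T v := fun v hv => by
    rw [hdeg]
    have h1 := h.parity v hv
    have h2 := hloop v
    omega
  have hcut : ∀ A, cutWeight m (incidences P a b) S A
      = (∑ i ∈ N, if (a i ∈ A ↔ b i ∈ A) then (0 : ℤ) else 1) + ∑ v ∈ A, incidences P a b v := by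
    intro A
    rw [cutWeight]
    congr 1
    have : ∑ x ∈ A, ∑ y ∈ S \ A, m x y
        = ∑ i ∈ N', ∑ x ∈ A, ∑ y ∈ S \ A, edgeInd (a i) (b i) x y := by
      simp only [m]
      rw [Finset.sum_congr rfl fun x _ => Finset.sum_comm, Finset.sum_comm]
    rw [this, Finset.sum_congr rfl fun i hi => cut_edgeInd (hmem i hi).1 (hmem i hi).2.1, hN',
      Finset.sum_filter]
    refine Finset.sum_congr rfl fun i _ => ?_
    by_cases e : a i = b i <;> simp [e]
  have hψ : ∑ v ∈ S, ψ v = 2 * (2 * x - P.card) := by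
    simp only [ψ]
    rw [sum_sum_vertInd h.memP, hsum]
  have hadm : IsAdmissible k S m (incidences P a b) ψ T o := by
    refine ⟨hsymm, hdiag, fun u v => Finset.sum_nonneg fun i _ => edgeInd_nonneg _ _ _ _, ?_, ?_,
      hpar, ?_, ?_, fun hv => absurd hv ho, ?_⟩
    · intro v _
      refine (Finset.abs_sum_le_sum_abs _ _).trans (Finset.sum_le_sum fun i _ => ?_)
      rw [abs_mul, hs₁, one_mul, abs_of_nonneg (add_nonneg (vertInd_nonneg _ _) (vertInd_nonneg _ _))]
    · intro v _
      simp only [ψ, incidences]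
      rw [← Finset.sum_sub_distrib]
      refine Finset.dvd_sum fun i _ => ?_
      rcases hs₁' i with e | e <;> rw [e] <;> omega
    · rw [hψ]; exact hx
    · have e := sum_sum_vertInd h.memP (fun _ => 1)
      simp only [one_mul, Finset.sum_const, nsmul_eq_mul, mul_one] at e
      have := modNorm_nonneg hk0 (∑ v ∈ S, ψ v)
      simp only [incidences]
      rw [e]
      omega
    · intro A hA hne hAS _
      -- The condition asks for up to `3 * k - 2` edges, one more than connectivity gives. When the
      -- norm is `k`, parity excludes a cut with exactly `3 * k - 3` edges.
      have h1 := h.conn A hA hne hAS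
      have h2 : 0 ≤ ∑ v ∈ A, incidences P a b v := Finset.sum_nonneg fun v _ =>
        Finset.sum_nonneg fun i _ => add_nonneg (vertInd_nonneg _ _) (vertInd_nonneg _ _)
      have h3 := hcut A
      have h4 := cutWeight_add_inner (m := m) (w := incidences P a b) hA
      have h5 := two_dvd_sum_sum hsymm hdiag A
      have h6 : 2 ∣ ∑ a' ∈ A, (∑ u ∈ S, m a' u + incidences P a b a' - T a') :=
        Finset.dvd_sum fun v hv => hpar v (hA hv)
      rw [Finset.sum_sub_distrib] at h6
      have h7 := two_dvd_modNorm_sub hk0 (∑ v ∈ A, T v)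
      have h8 := modNorm_le hk0 (∑ v ∈ A, T v)
      omega
  obtain ⟨φ, hφ⟩ := hadm.exists_flow hk
  obtain ⟨s₂, hs₂, hs⟩ := exists_signs_of_flow N' hmem φ hφ.antisymm hφ.abs_le hφ.parity
  refine ⟨fun i => if i ∈ P then s₁ i else s₂ i, fun i => by
    dsimp only
    split_ifs
    · exact hs₁ i
    · exact hs₂ i, fun v hv => ?_⟩
  have e : netDegree N P a b (fun i => if i ∈ P then s₁ i else s₂ i) v
      = ∑ u ∈ S, φ v u + ψ v := by
    rw [netDegree, ← hs v hv]
    congr 1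
    · rw [hN', Finset.sum_filter]
      refine Finset.sum_congr rfl fun i hi => ?_
      rw [if_neg (Finset.disjoint_left.1 h.disj hi)]
      by_cases e : a i = b i <;> simp [e]
    · exact Finset.sum_congr rfl fun i hi => by rw [if_pos hi]
  rw [e]
  exact ⟨hφ.congr v hv, hφ.bound v hv⟩

/-- An integer may be replaced modulo `k` by one between `0` and `n`, if `n` is large enough. -/
lemma exists_total (hk : 0 < k) (x n : ℤ) (hn : k - 1 ≤ n) {y : ℤ}
    (h : 2 * k ∣ y - 2 * (2 * x - n)) :
    ∃ x' : ℤ, 0 ≤ x' ∧ x' ≤ n ∧ 2 * k ∣ y - 2 * (2 * x' - n) := by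
  have h1 := Int.emod_nonneg x (b := k) (by omega)
  have h2 := Int.emod_lt_of_pos x hk
  have h3 := Int.mul_ediv_add_emod x k
  refine ⟨x % k, h1, by omega, ?_⟩
  obtain ⟨c, hc⟩ := h
  refine ⟨c + 2 * (x / k), ?_⟩
  linarith

end Signed

/-! ### Merging and presetting the edges with equal signs at their ends -/

section Signed

variable {V ι : Type*} [DecidableEq V]
variable {k : ℤ} {S : Finset V} {N P : Finset ι} {a b : ι → V} {T : V → ℤ}

/-- Two edges share an end. -/
def EdgesMeet (a b : ι → V) (i j : ι) : Prop :=
  a i = a j ∨ a i = b j ∨ b i = a j ∨ b i = b j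

/-- Two edges that meet are `uv` and `vx` for suitable vertices. -/
lemma exists_common_end {i j : ι} (h : EdgesMeet a b i j) (hi : a i ∈ S ∧ b i ∈ S)
    (hj : a j ∈ S ∧ b j ∈ S) :
    ∃ u v x, u ∈ S ∧ x ∈ S ∧ (∀ z, vertInd (a i) z + vertInd (b i) z = vertInd u z + vertInd v z) ∧
      ∀ z, vertInd (a j) z + vertInd (b j) z = vertInd v z + vertInd x z := by
  rcases h with h | h | h | h
  · exact ⟨b i, a i, b j, hi.2, hj.2, fun z => add_comm _ _, fun z => by rw [h]⟩
  · exact ⟨b i, a i, a j, hi.2, hj.1, fun z => add_comm _ _, fun z => by rw [h]; exact add_comm _ _⟩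
  · exact ⟨a i, b i, b j, hi.1, hj.2, fun z => rfl, fun z => by rw [h]⟩
  · exact ⟨a i, b i, a j, hi.1, hj.1, fun z => rfl, fun z => by rw [h]; exact add_comm _ _⟩

variable [DecidableEq ι]

lemma sum_erase_erase {i j : ι} (hi : i ∈ P) (hj : j ∈ P) (hij : i ≠ j) (g : ι → ℤ) :
    ∑ l ∈ P, g l = g i + g j + ∑ l ∈ (P.erase i).erase j, g l := by
  rw [← Finset.add_sum_erase P g hi,
    ← Finset.add_sum_erase (P.erase i) g (Finset.mem_erase.2 ⟨hij.symm, hj⟩), add_assoc]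

/-- Two edges of `P` with a common end may be replaced by one edge between the other ends. -/
lemma IsSignable.split (hk : 0 < k) (h : IsSignable k S N P a b T) (hP : k + 1 ≤ (P.card : ℤ))
    {i j : ι} (hi : i ∈ P) (hj : j ∈ P) (hij : i ≠ j) {u v x : V} (hu : u ∈ S) (hx : x ∈ S)
    (hiv : ∀ z, vertInd (a i) z + vertInd (b i) z = vertInd u z + vertInd v z)
    (hjv : ∀ z, vertInd (a j) z + vertInd (b j) z = vertInd v z + vertInd x z) :
    IsSignable k S (insert i N) ((P.erase i).erase j) (Function.update a i u)
      (Function.update b i x) T := by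
  have hiN : i ∉ N := fun hh => Finset.disjoint_left.1 h.disj hh hi
  have hsub : (P.erase i).erase j ⊆ P := (Finset.erase_subset _ _).trans (Finset.erase_subset _ _)
  have hN : ∀ l ∈ N, l ≠ i := fun l hl e => hiN (e ▸ hl)
  have hP' : ∀ l ∈ (P.erase i).erase j, l ≠ i := fun l hl =>
    Finset.ne_of_mem_erase (Finset.mem_of_mem_erase hl)
  have hcard : (((P.erase i).erase j).card : ℤ) = P.card - 2 := by
    rw [Finset.card_erase_of_mem (Finset.mem_erase.2 ⟨hij.symm, hj⟩), Finset.card_erase_of_mem hi]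
    omega
  refine ⟨?_, ?_, ?_, ?_, ?_, ?_⟩
  · rw [Finset.disjoint_insert_left]
    exact ⟨by simp, Finset.disjoint_of_subset_right hsub h.disj⟩
  · intro l hl
    rcases Finset.mem_insert.1 hl with rfl | hl
    · simp [hu, hx]
    · simpa [hN l hl] using h.memN l hl
  · intro l hl
    simpa [hP' l hl] using h.memP l (hsub hl)
  · intro z hz
    have h1 := h.parity z hz
    have e1 : incidences (insert i N) (Function.update a i u) (Function.update b i x) z
        = vertInd u z + vertInd x z + incidences N a b z := by
      rw [incidences, Finset.sum_insert hiN, incidences]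
      simp only [Function.update_self]
      congr 1
      exact Finset.sum_congr rfl fun l hl => by simp [hN l hl]
    have e2 : incidences ((P.erase i).erase j) (Function.update a i u) (Function.update b i x) z
        = incidences ((P.erase i).erase j) a b z :=
      Finset.sum_congr rfl fun l hl => by simp [hP' l hl]
    have e3 : incidences P a b z = _ := sum_erase_erase hi hj hij _
    rw [hiv, hjv] at e3
    rw [e1, e2]
    simp only [incidences] at *
    omega
  · intro A hA hne hAS
    have h1 := h.conn A hA hne hAS
    rw [Finset.sum_insert hiN]
    have e : ∑ l ∈ N, (if (Function.update a i u l ∈ A ↔ Function.update b i x l ∈ A) then (0 : ℤ)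
        else 1) = ∑ l ∈ N, if (a l ∈ A ↔ b l ∈ A) then (0 : ℤ) else 1 :=
      Finset.sum_congr rfl fun l hl => by simp [hN l hl]
    rw [e]
    split_ifs <;> omega
  -- The merged pair has opposite signs, so one positive sign disappears. At least `k - 1` edges
  -- remain in `P`, hence the count can be reduced modulo `k` to an attainable one.
  · obtain ⟨y, -, -, hy⟩ := h.total
    rw [hcard]
    refine exists_total hk (y - 1) _ (by omega) ?_
    convert hy using 1
    ring

/-- Giving `j` the sign opposite to `i` cancels both contributions at `v` and leaves opposite ones
at `u` and `x`. -/
lemma netDegree_split (hd : Disjoint N P) {i j : ι} (hi : i ∈ P) (hj : j ∈ P) (hij : i ≠ j)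
    {u v x : V} (hiv : ∀ z, vertInd (a i) z + vertInd (b i) z = vertInd u z + vertInd v z)
    (hjv : ∀ z, vertInd (a j) z + vertInd (b j) z = vertInd v z + vertInd x z) (s : ι → ℤ) (z : V) :
    netDegree N P a b (Function.update s j (-s i)) z
      = netDegree (insert i N) ((P.erase i).erase j) (Function.update a i u)
        (Function.update b i x) s z := by
  have hiN : i ∉ N := fun hh => Finset.disjoint_left.1 hd hh hi
  have hjN : j ∉ N := fun hh => Finset.disjoint_left.1 hd hh hj
  have hN : ∀ l ∈ N, l ≠ i := fun l hl e => hiN (e ▸ hl)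
  have hNj : ∀ l ∈ N, l ≠ j := fun l hl e => hjN (e ▸ hl)
  have hP' : ∀ l ∈ (P.erase i).erase j, l ≠ i := fun l hl =>
    Finset.ne_of_mem_erase (Finset.mem_of_mem_erase hl)
  have hPj : ∀ l ∈ (P.erase i).erase j, l ≠ j := fun l hl => Finset.ne_of_mem_erase hl
  rw [netDegree, netDegree, sum_erase_erase hi hj hij, Finset.sum_insert hiN, hiv, hjv]
  simp only [Function.update_self, Function.update_of_ne hij]
  have e1 : ∑ l ∈ N, Function.update s j (-s i) l * (vertInd (a l) z - vertInd (b l) z)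
      = ∑ l ∈ N, s l * (vertInd (Function.update a i u l) z - vertInd (Function.update b i x l) z) :=
    Finset.sum_congr rfl fun l hl => by simp [hN l hl, hNj l hl]
  have e2 : ∑ l ∈ (P.erase i).erase j, Function.update s j (-s i) l *
        (vertInd (a l) z + vertInd (b l) z)
      = ∑ l ∈ (P.erase i).erase j, s l *
        (vertInd (Function.update a i u l) z + vertInd (Function.update b i x l) z) :=
    Finset.sum_congr rfl fun l hl => by simp [hP' l hl, hPj l hl]
  rw [e1, e2]
  ring

/-- The sign of an isolated edge of `P`, chosen so as to respect the degree bounds. -/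
lemma exists_loop_sign (hk : 2 ≤ k) (τ : ℤ) :
    ∃ η : ℤ, |η| = 1 ∧ ∀ D, 2 * k ∣ D - (τ - 2 * η) → |D| ≤ 2 * k - 1 →
      -(2 * k) < D + 2 * η ∧ D + 2 * η ≤ 2 * k := by
  -- With `η = 1` the upper bound fails only for `D = 2 * k - 1`, which forces `τ` to be `1` modulo
  -- `2 * k`. In that case `η = -1` makes `D` congruent to `3`, far enough from the lower bound.
  by_cases h : 2 * k ∣ τ - 1
  · refine ⟨-1, by simp, fun D hD hb => ?_⟩
    rw [abs_le] at hb
    obtain ⟨c, hc⟩ := h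
    obtain ⟨d, hd⟩ := hD
    have e : D - 3 = 2 * k * (c + d) := by linarith
    have : ¬ D + 2 * (-1) ≤ -(2 * k) := by
      intro hh
      have h1 : c + d < 0 := by by_contra! h'; nlinarith
      have h2 : -2 < c + d := by by_contra! h'; nlinarith
      rw [show c + d = -1 by omega] at e
      omega
    omega
  · refine ⟨1, by simp, fun D hD hb => ?_⟩
    rw [abs_le] at hb
    have : D ≠ 2 * k - 1 := by
      rintro rfl
      apply h
      obtain ⟨d, hd⟩ := hD
      exact ⟨1 - d, by linarith⟩
    omega

/-- Pairwise disjoint edges of `P` can be given signs in advance. -/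
lemma IsSignable.exists_signs_of_disjoint (hk : 2 ≤ k) (h : IsSignable k S N P a b T) {o : V}
    (ho : o ∉ S) {ε : V → ℤ} (hε : ∀ v, |ε v| = 1) (hεP : ∀ i ∈ P, ε (a i) = ε (b i))
    {K : Finset ι} (hK : K ⊆ P) (hKcard : (K.card : ℤ) = P.card - (k - 1))
    (hdis : ∀ i ∈ K, ∀ j ∈ K, i ≠ j → ¬ EdgesMeet a b i j) :
    ∃ s : ι → ℤ, (∀ i, |s i| = 1) ∧ ∀ v ∈ S, 2 * k ∣ netDegree N P a b s v - T v ∧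
      -(2 * k) < ε v * netDegree N P a b s v ∧ ε v * netDegree N P a b s v ≤ 2 * k := by
  have hk0 : 0 < k := by omega
  have hε' : ∀ v, ε v = 1 ∨ ε v = -1 := fun v => by
    have := hε v
    rcases abs_choice (ε v) with e | e <;> omega
  choose η hη1 hη2 using fun v => exists_loop_sign hk (ε v * T v)
  -- By disjointness at most one edge of `K` meets a given vertex. A non-loop adds `1` after
  -- multiplication by `ε`, which the upper bound `2 * k` tolerates; a loop adds `2 * η`, with `η`
  -- adapted to the residue.
  let σ : ι → ℤ := fun i => if a i = b i then ε (a i) * η (a i) else ε (a i)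
  have hσ1 : ∀ i, |σ i| = 1 := fun i => by
    simp only [σ]
    split_ifs
    · rw [abs_mul, hε, hη1]; rfl
    · exact hε _
  have hσ' : ∀ i, σ i = 1 ∨ σ i = -1 := fun i => by
    have := hσ1 i
    rcases abs_choice (σ i) with e | e <;> omega
  let δ : V → ℤ := fun v => ∑ i ∈ K, σ i * (vertInd (a i) v + vertInd (b i) v)
  have hPK : ∀ g : ι → ℤ, ∑ i ∈ P, g i = ∑ i ∈ P \ K, g i + ∑ i ∈ K, g i := fun g =>
    (Finset.sum_sdiff hK).symm
  have hcard : ((P \ K).card : ℤ) = k - 1 := by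
    have := Finset.card_le_card hK
    rw [Finset.card_sdiff_of_subset hK]
    omega
  have hR : IsSignable k S N (P \ K) a b (fun v => T v - δ v) := by
    refine ⟨Finset.disjoint_of_subset_right Finset.sdiff_subset h.disj, h.memN,
      fun i hi => h.memP i (Finset.mem_sdiff.1 hi).1, ?_, h.conn, ?_⟩
    · intro v hv
      have h1 := h.parity v hv
      have h2 : incidences P a b v = incidences (P \ K) a b v + incidences K a b v := hPK _
      have h3 : 2 ∣ incidences K a b v - δ v := by
        simp only [incidences, δ]
        rw [← Finset.sum_sub_distrib]
        refine Finset.dvd_sum fun i _ => ?_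
        rcases hσ' i with e | e <;> rw [e] <;> omega
      omega
    · obtain ⟨y, -, -, hy⟩ := h.total
      have hsum : ∑ v ∈ S, δ v = 2 * ∑ i ∈ K, σ i :=
        sum_sum_vertInd (fun i hi => h.memP i (hK hi)) σ
      have hpar : 2 ∣ ∑ i ∈ K, σ i + K.card := by
        have e : (K.card : ℤ) = ∑ i ∈ K, 1 := by simp
        rw [e, ← Finset.sum_add_distrib]
        refine Finset.dvd_sum fun i _ => ?_
        rcases hσ' i with e | e <;> rw [e] <;> norm_num
      obtain ⟨c, hc⟩ := hpar
      rw [hcard]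
      refine exists_total hk0 (y - c) _ le_rfl ?_
      rw [Finset.sum_sub_distrib, hsum]
      obtain ⟨d, hd⟩ := hy
      exact ⟨d, by linarith⟩
  obtain ⟨s, hs, hsv⟩ := hR.exists_signs_of_card_lt hk ho (by omega)
  refine ⟨fun i => if i ∈ K then σ i else s i, fun i => by
    dsimp only
    split_ifs
    · exact hσ1 i
    · exact hs i, fun v hv => ?_⟩
  have e : netDegree N P a b (fun i => if i ∈ K then σ i else s i) v
      = netDegree N (P \ K) a b s v + δ v := by
    rw [netDegree, netDegree, hPK, ← add_assoc]
    congr 1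
    · congr 1
      · exact Finset.sum_congr rfl fun i hi => by
          rw [if_neg fun hh => Finset.disjoint_left.1 h.disj hi (hK hh)]
      · exact Finset.sum_congr rfl fun i hi => by rw [if_neg (Finset.mem_sdiff.1 hi).2]
    · exact Finset.sum_congr rfl fun i hi => by rw [if_pos hi]
  obtain ⟨h1, h2⟩ := hsv v hv
  rw [e]
  set D := netDegree N (P \ K) a b s v
  refine ⟨by convert h1 using 1; ring, ?_⟩
  have habs : |ε v * D| ≤ 2 * k - 1 := by rwa [abs_mul, hε, one_mul]
  rw [mul_add]
  by_cases hex : ∃ i ∈ K, a i = v ∨ b i = v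
  · obtain ⟨i, hi, hiv⟩ := hex
    have hδ : δ v = σ i * (vertInd (a i) v + vertInd (b i) v) := by
      refine Finset.sum_eq_single_of_mem i hi fun j hj hji => ?_
      have hm := hdis j hj i hi hji
      simp only [EdgesMeet, not_or] at hm
      have h3 : v ≠ a j := by
        rintro rfl
        rcases hiv with e | e
        · exact hm.1 e.symm
        · exact hm.2.1 e.symm
      have h4 : v ≠ b j := by
        rintro rfl
        rcases hiv with e | e
        · exact hm.2.2.1 e.symm
        · exact hm.2.2.2 e.symm
      simp [vertInd, h3, h4]
    have hεv : ε (a i) = ε v := by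
      rcases hiv with e | e
      · rw [e]
      · rw [hεP i (hK hi), e]
    have hsq : ε v * ε v = 1 := by rcases hε' v with e | e <;> rw [e] <;> rfl
    by_cases hl : a i = b i
    · have hav : a i = v := by
        rcases hiv with e | e
        · exact e
        · exact hl.trans e
      have e2 : ε v * δ v = 2 * η v := by
        rw [hδ]
        simp only [σ, if_pos hl, vertInd, ← hl, hav, if_true]
        linear_combination 2 * η v * hsq
      rw [e2]
      refine hη2 v _ ?_ habs
      obtain ⟨c, hc⟩ := h1
      refine ⟨ε v * c, ?_⟩
      rw [← e2]
      linear_combination ε v * hc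
    · have e1 : vertInd (a i) v + vertInd (b i) v = 1 := by
        rcases hiv with e | e
        · have : v ≠ b i := fun e' => hl (e.trans e')
          simp [vertInd, e, this]
        · have : v ≠ a i := fun e' => hl (e'.symm.trans e.symm)
          simp [vertInd, e, this]
      have e2 : ε v * δ v = 1 := by
        rw [hδ, e1]
        simp only [σ, if_neg hl, hεv]
        linarith
      rw [e2]
      rw [abs_le] at habs
      omega
  · push Not at hex
    have hδ : δ v = 0 := Finset.sum_eq_zero fun i hi => by
      have := hex i hi
      simp [vertInd, this.1.symm, this.2.symm]
    rw [hδ, mul_zero, add_zero]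
    rw [abs_le] at habs
    omega

/-- The existence theorem for signs with prescribed net degrees modulo `2 * k`. -/
theorem IsSignable.exists_signs (hk : 2 ≤ k) (h : IsSignable k S N P a b T) {o : V}
    (ho : o ∉ S) {ε : V → ℤ} (hε : ∀ v, |ε v| = 1) (hεP : ∀ i ∈ P, ε (a i) = ε (b i)) :
    ∃ s : ι → ℤ, (∀ i, |s i| = 1) ∧ ∀ v ∈ S, 2 * k ∣ netDegree N P a b s v - T v ∧
      -(2 * k) < ε v * netDegree N P a b s v ∧ ε v * netDegree N P a b s v ≤ 2 * k := by
  obtain ⟨n, hn⟩ : ∃ n, n = P.card := ⟨_, rfl⟩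
  induction n using Nat.strong_induction_on generalizing N P a b with
  | _ n ih =>
  rcases le_or_gt (P.card : ℤ) (k - 1) with hP | hP
  · obtain ⟨s, hs, hsv⟩ := h.exists_signs_of_card_lt hk ho hP
    refine ⟨s, hs, fun v hv => ⟨(hsv v hv).1, ?_⟩⟩
    have : |ε v * netDegree N P a b s v| ≤ 2 * k - 1 := by
      rw [abs_mul, hε, one_mul]; exact (hsv v hv).2
    rw [abs_le] at this
    omega
  -- Merging needs `k + 1` edges so that `k - 1` survive. If `P` has exactly `k` edges, the set `K`
  -- below has one element and is trivially pairwise disjoint.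
  by_cases hmeet : k + 1 ≤ (P.card : ℤ) ∧ ∃ i ∈ P, ∃ j ∈ P, i ≠ j ∧ EdgesMeet a b i j
  · obtain ⟨hP1, i, hi, j, hj, hij, hm⟩ := hmeet
    obtain ⟨u, v, x, hu, hx, hiv, hjv⟩ := exists_common_end hm (h.memP i hi) (h.memP j hj)
    have hlt : ((P.erase i).erase j).card < n := by
      rw [hn]
      exact (Finset.card_le_card (Finset.erase_subset _ _)).trans_lt (Finset.card_erase_lt_of_mem hi)
    obtain ⟨s, hs, hsv⟩ := ih _ hlt (h.split (by omega) hP1 hi hj hij hu hx hiv hjv)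
      (fun l hl => by
        have h1 : l ≠ i := Finset.ne_of_mem_erase (Finset.mem_of_mem_erase hl)
        simpa [h1] using hεP l (Finset.mem_of_mem_erase (Finset.mem_of_mem_erase hl))) rfl
    refine ⟨Function.update s j (-s i), fun l => ?_, fun z hz => ?_⟩
    · by_cases e : l = j
      · rw [e, Function.update_self, abs_neg]; exact hs i
      · rw [Function.update_of_ne e]; exact hs l
    · rw [netDegree_split h.disj hi hj hij hiv hjv]
      exact hsv z hz
  · obtain ⟨K, hK, hKc⟩ := Finset.exists_subset_card_eq (s := P) (n := P.card - (k - 1).toNat)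
      (Nat.sub_le _ _)
    refine h.exists_signs_of_disjoint hk ho hε hεP hK (by omega) fun i hi j hj hij hm => ?_
    apply hmeet
    refine ⟨?_, i, hK hi, j, hK hj, hij, hm⟩
    have : 1 < K.card := Finset.one_lt_card.2 ⟨i, hi, j, hj, hij⟩
    omega

/-! #### Almost balanced signs -/

/-- A function on the vertices of the form `±1_u ± 1_v`. -/
def IsEdgeVector (g : V → ℤ) (u v : V) : Prop :=
  ∃ α β : ℤ, |α| = 1 ∧ |β| = 1 ∧ ∀ z, g z = α * vertInd u z + β * vertInd v z

lemma IsEdgeVector.symm {g : V → ℤ} {u v : V} (h : IsEdgeVector g u v) : IsEdgeVector g v u := by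
  obtain ⟨α, β, hα, hβ, h⟩ := h
  exact ⟨β, α, hβ, hα, fun z => by rw [h, add_comm]⟩

/-- Signs can be chosen such that every signed sum lies between `-1` and `2`. -/
theorem exists_almost_balanced_signs (I : Finset ι) (g : ι → V → ℤ) (a b : ι → V)
    (hg : ∀ i ∈ I, IsEdgeVector (g i) (a i) (b i)) :
    ∃ s : ι → ℤ, (∀ i, |s i| = 1) ∧ ∀ v, -1 ≤ ∑ i ∈ I, s i * g i v ∧ ∑ i ∈ I, s i * g i v ≤ 2 := by
  obtain ⟨n, hn⟩ : ∃ n, n = I.card := ⟨_, rfl⟩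
  induction n using Nat.strong_induction_on generalizing I g a b with
  | _ n ih =>
  by_cases hmeet : ∃ i ∈ I, ∃ j ∈ I, i ≠ j ∧ EdgesMeet a b i j
  · obtain ⟨i, hi, j, hj, hij, hm⟩ := hmeet
    obtain ⟨u, v, x, hgi, hgj⟩ : ∃ u v x, IsEdgeVector (g i) u v ∧ IsEdgeVector (g j) v x := by
      rcases hm with h | h | h | h
      · exact ⟨b i, a i, b j, (hg i hi).symm, h ▸ hg j hj⟩
      · exact ⟨b i, a i, a j, (hg i hi).symm, h ▸ (hg j hj).symm⟩
      · exact ⟨a i, b i, b j, hg i hi, h ▸ hg j hj⟩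
      · exact ⟨a i, b i, a j, hg i hi, h ▸ (hg j hj).symm⟩
    obtain ⟨α, β, hα, hβ, hgi⟩ := hgi
    obtain ⟨γ, ζ, hγ, hζ, hgj⟩ := hgj
    have hγ2 : γ * γ = 1 := by rw [← abs_mul_abs_self, hγ]; rfl
    -- The vectors of `i` and `j` are combined so as to cancel at the common end `v`, leaving an
    -- edge vector on `u` and `x`.
    let g' := Function.update g i fun z => g i z - β * γ * g j z
    obtain ⟨s, hs, hsv⟩ := ih (I.erase j).card (hn ▸ Finset.card_erase_lt_of_mem hj) (I.erase j) g'
      (Function.update a i u) (Function.update b i x) (fun l hl => by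
        by_cases e : l = i
        · subst e
          refine ⟨α, -(β * γ * ζ), hα, by simp [abs_mul, hβ, hγ, hζ], fun z => ?_⟩
          simp only [g', Function.update_self]
          rw [hgi, hgj]
          linear_combination -β * vertInd v z * hγ2
        · simp only [g', Function.update_of_ne e]
          exact hg l (Finset.mem_of_mem_erase hl)) rfl
    refine ⟨Function.update s j (-(β * γ) * s i), fun l => ?_, fun z => ?_⟩
    · by_cases e : l = j
      · rw [e, Function.update_self, abs_mul, abs_neg, abs_mul, hβ, hγ, hs]; rfl
      · rw [Function.update_of_ne e]; exact hs l
    · convert hsv z using 2 <;>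
      · have hi' : i ∈ I.erase j := Finset.mem_erase.2 ⟨hij, hi⟩
        rw [← Finset.add_sum_erase I _ hj, ← Finset.add_sum_erase (I.erase j) _ hi',
          ← Finset.add_sum_erase (I.erase j) (fun l => s l * g' l z) hi']
        simp only [g', Function.update_self, Function.update_of_ne hij]
        have : ∑ l ∈ (I.erase j).erase i, Function.update s j (-(β * γ) * s i) l * g l z
            = ∑ l ∈ (I.erase j).erase i,
              s l * Function.update g i (fun z => g i z - β * γ * g j z) l z :=
          Finset.sum_congr rfl fun l hl => by
            rw [Function.update_of_ne (Finset.ne_of_mem_erase (Finset.mem_of_mem_erase hl)),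
              Function.update_of_ne (Finset.ne_of_mem_erase hl)]
        rw [this]
        ring
  · push Not at hmeet
    -- Now at most one edge meets each vertex. The sign `α i` makes the coefficient at `a i` equal
    -- to `1`; the one at `b i` is `1` or `-1`, so coinciding ends give `2` or `0`.
    choose! α β hα hβ h using hg
    refine ⟨fun i => if i ∈ I then α i else 1, fun i => ?_, fun v => ?_⟩
    · dsimp only
      split_ifs with hi
      · exact hα i hi
      · simp
    by_cases hex : ∃ i ∈ I, a i = v ∨ b i = v
    · obtain ⟨i, hi, hiv⟩ := hex
      rw [Finset.sum_eq_single_of_mem i hi]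
      · dsimp only
        rw [if_pos hi, h i hi]
        have h1 := hα i hi
        have h2 := hβ i hi
        have hα' : α i = 1 ∨ α i = -1 := by rcases abs_choice (α i) with e | e <;> omega
        have hβ' : β i = 1 ∨ β i = -1 := by rcases abs_choice (β i) with e | e <;> omega
        unfold vertInd
        rcases hα' with e | e <;> rcases hβ' with e' | e' <;> rw [e, e'] <;> split_ifs <;> norm_num
      · intro j hj hji
        have hm := hmeet j hj i hi hji
        simp only [EdgesMeet, not_or] at hm
        have h3 : v ≠ a j := by
          rintro rfl
          rcases hiv with e | e
          · exact hm.1 e.symm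
          · exact hm.2.1 e.symm
        have h4 : v ≠ b j := by
          rintro rfl
          rcases hiv with e | e
          · exact hm.2.2.1 e.symm
          · exact hm.2.2.2 e.symm
        rw [h j hj]
        simp [vertInd, h3, h4]
    · push Not at hex
      rw [Finset.sum_eq_zero]
      · norm_num
      · intro i hi
        have := hex i hi
        rw [h i hi]
        simp [vertInd, this.1.symm, this.2.symm]

end Signed

section Signed

variable {V ι : Type*} [DecidableEq V] [DecidableEq ι]
variable {k : ℤ} {S : Finset V} {N P : Finset ι} {a b : ι → V} {T : V → ℤ}

lemma vertInd_some (u v : V) : vertInd (some u) (some v) = vertInd u v := by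
  simp [vertInd]

/-- `IsSignable.exists_signs` without the assumption of a vertex outside `S`. -/
theorem IsSignable.exists_signs_of_sides (hk : 2 ≤ k) (h : IsSignable k S N P a b T) {ε : V → ℤ}
    (hε : ∀ v, |ε v| = 1) (hεP : ∀ i ∈ P, ε (a i) = ε (b i)) :
    ∃ s : ι → ℤ, (∀ i, |s i| = 1) ∧ ∀ v ∈ S, 2 * k ∣ netDegree N P a b s v - T v ∧
      -(2 * k) < ε v * netDegree N P a b s v ∧ ε v * netDegree N P a b s v ≤ 2 * k := by
  -- Passing to `Option V` makes `none` available as a vertex outside `S`, which serves as the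
  -- absent exempt vertex.
  have h' : IsSignable k (S.map Function.Embedding.some) N P (fun i => some (a i))
      (fun i => some (b i)) (fun v => v.elim 0 T) := by
    refine ⟨h.disj, fun i hi => by simpa using h.memN i hi, fun i hi => by simpa using h.memP i hi,
      fun v hv => ?_, fun A hA hne hAS => ?_, ?_⟩
    · obtain ⟨v, hvS, rfl⟩ := Finset.mem_map.1 hv
      simpa [incidences, vertInd_some] using h.parity v hvS
    · have hmap : A.eraseNone.map Function.Embedding.some = A := by
        ext v
        constructor
        · intro hv
          obtain ⟨v, hvA, rfl⟩ := Finset.mem_map.1 hv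
          exact Finset.mem_eraseNone.1 hvA
        · intro hv
          obtain ⟨u, hu, rfl⟩ := Finset.mem_map.1 (hA hv)
          exact Finset.mem_map_of_mem _ (Finset.mem_eraseNone.2 hv)
      have := h.conn A.eraseNone
        (fun v hv => by simpa using hA (Finset.mem_eraseNone.1 hv))
        (by rw [← hmap] at hne; exact Finset.map_nonempty.1 hne)
        (fun e => hAS (by rw [← hmap, e]))
      simpa [Finset.mem_eraseNone] using this
    · obtain ⟨x, h0, h1, h2⟩ := h.total
      exact ⟨x, h0, h1, by simpa using h2⟩
  obtain ⟨s, hs, hsv⟩ := h'.exists_signs hk (o := none) (by simp) (ε := fun v => v.elim 1 ε)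
    (fun v => by cases v <;> simp [hε]) (by simpa using hεP)
  refine ⟨s, hs, fun v hv => ?_⟩
  simpa [netDegree, vertInd_some] using hsv (some v) (by simpa using hv)

end Signed

/-! ### Factors from signs -/

section Factor

variable {α β : Type*} {G : Graph α β} {a b : β → α}

open scoped Classical in
lemma degree_restrict (hE : E(G).Finite) (hab : ∀ e ∈ E(G), G.IsLink e (a e) (b e)) (F : Set β)
    (v : α) : (degree (G.restrict F) v : ℤ) =
      ∑ e ∈ hE.toFinset, if e ∈ F then vertInd (a e) v + vertInd (b e) v else 0 := by
  have h1 : {e | (G.restrict F).Inc e v} =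
      ↑(hE.toFinset.filter fun e => e ∈ F ∧ (v = a e ∨ v = b e)) := by
    ext e
    simp only [Set.mem_ofPred_eq, Graph.restrict_inc, Finset.coe_filter, Set.Finite.mem_toFinset]
    constructor
    · rintro ⟨h, hF⟩
      exact ⟨h.edge_mem, hF, h.eq_or_eq_of_isLink (hab e h.edge_mem)⟩
    · rintro ⟨he, hF, rfl | rfl⟩
      · exact ⟨(hab e he).inc_left, hF⟩
      · exact ⟨(hab e he).inc_right, hF⟩
  have h2 : {e | (G.restrict F).IsLoopAt e v} =
      ↑(hE.toFinset.filter fun e => e ∈ F ∧ v = a e ∧ v = b e) := by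
    ext e
    simp only [Set.mem_ofPred_eq, Graph.restrict_isLoopAt, Finset.coe_filter,
      Set.Finite.mem_toFinset]
    constructor
    · rintro ⟨h, hF⟩
      have := hab e h.edge_mem
      exact ⟨h.edge_mem, hF, h.eq_of_inc this.inc_left, h.eq_of_inc this.inc_right⟩
    · rintro ⟨he, hF, h, h'⟩
      have := hab e he
      rw [← h, ← h'] at this
      exact ⟨this, hF⟩
  rw [degree, h1, h2, Set.ncard_coe_finset, Set.ncard_coe_finset, Finset.card_filter,
    Finset.card_filter, ← Finset.sum_add_distrib, Nat.cast_sum]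
  refine Finset.sum_congr rfl fun e _ => ?_
  unfold vertInd
  by_cases hF : e ∈ F <;> by_cases h : v = a e <;> by_cases h' : v = b e <;>
    simp only [hF, h, h', true_and, false_and, and_true, and_false, or_true, true_or, or_false,
      if_true, if_false] <;> norm_num [add_comm]

open scoped Classical in
lemma degree_eq_sum (hE : E(G).Finite) (hab : ∀ e ∈ E(G), G.IsLink e (a e) (b e)) (v : α) :
    (degree G v : ℤ) = ∑ e ∈ hE.toFinset, (vertInd (a e) v + vertInd (b e) v) := by
  have := degree_restrict hE hab Set.univ v
  rw [(Graph.restrict_eq_self_iff G Set.univ).2 (Set.subset_univ _)] at this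
  simpa using this

open scoped Classical in
lemma two_mul_degree_restrict_sub (hE : E(G).Finite) (hab : ∀ e ∈ E(G), G.IsLink e (a e) (b e))
    {s : β → ℤ} (hs : ∀ e, |s e| = 1) (v : α) :
    2 * (degree (G.restrict {e | s e = 1}) v : ℤ) - degree G v =
      ∑ e ∈ hE.toFinset, s e * (vertInd (a e) v + vertInd (b e) v) := by
  rw [degree_restrict hE hab, degree_eq_sum hE hab, Finset.mul_sum, ← Finset.sum_sub_distrib]
  refine Finset.sum_congr rfl fun e _ => ?_
  have h : s e = 1 ∨ s e = -1 := by
    have := hs e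
    rcases abs_choice (s e) with h | h <;> omega
  rcases h with h | h <;> simp [h]
  ring

lemma restrict_isSpanningSubgraph (F : Set β) : G.restrict F ≤s G :=
  ⟨Graph.restrict_le, rfl⟩

open scoped Classical in
lemma edgesInside_eq_sum (hE : E(G).Finite) (hab : ∀ e ∈ E(G), G.IsLink e (a e) (b e))
    (A : Set α) :
    edgesInside G A = ∑ e ∈ hE.toFinset, if a e ∈ A ∧ b e ∈ A then 1 else 0 := by
  have : {e | ∃ x ∈ A, ∃ y ∈ A, G.IsLink e x y} =
      ↑(hE.toFinset.filter fun e => a e ∈ A ∧ b e ∈ A) := by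
    ext e
    simp only [Set.mem_ofPred_eq, Finset.coe_filter, Set.Finite.mem_toFinset]
    constructor
    · rintro ⟨x, hx, y, hy, h⟩
      refine ⟨h.edge_mem, ?_⟩
      rcases h.eq_and_eq_or_eq_and_eq (hab e h.edge_mem) with ⟨rfl, rfl⟩ | ⟨rfl, rfl⟩
      · exact ⟨hx, hy⟩
      · exact ⟨hy, hx⟩
    · rintro ⟨he, h1, h2⟩
      exact ⟨_, h1, _, h2, hab e he⟩
  rw [edgesInside, this, Set.ncard_coe_finset, Finset.card_filter]

open scoped Classical in
lemma finsum_mem_eq_sum_ite {M : Type*} [AddCommMonoid M] {S : Finset α} {X : Set α}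
    (h : X ⊆ S) (f : α → M) : ∑ᶠ v ∈ X, f v = ∑ v ∈ S, if v ∈ X then f v else 0 := by
  have : X = ↑(S.filter (· ∈ X)) := by
    ext v
    simpa using fun hv => h hv
  rw [← Finset.sum_filter]
  conv_lhs => rw [this]
  exact finsum_mem_coe_finset _ _

open scoped Classical in
theorem exists_modFactor_of_one (hE : E(G).Finite)
    (hab : ∀ e ∈ E(G), G.IsLink e (a e) (b e)) (f : α → ZMod 1) :
    ∃ H : Graph α β, IsModFactor G f H ∧
      ∀ v, -1 ≤ 2 * (degree H v : ℤ) - degree G v ∧ 2 * (degree H v : ℤ) - degree G v ≤ 2 := by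
  obtain ⟨s, hs, hsv⟩ := exists_almost_balanced_signs hE.toFinset
    (fun e v => vertInd (a e) v + vertInd (b e) v) a b
    (fun e _ => ⟨1, 1, by simp, by simp, fun z => by ring⟩)
  refine ⟨G.restrict {e | s e = 1}, ⟨restrict_isSpanningSubgraph _, fun v _ =>
    Subsingleton.elim _ _⟩, fun v => ?_⟩
  rw [two_mul_degree_restrict_sub hE hab hs]
  exact hsv v

-- Translates between factors of `G` and signs twisted by the sides of `B`. Compatibility enters
-- only for the bipartition of `B`, and only to produce the field `total`.
open scoped Classical in
theorem exists_modFactor_of_two_le (hV : V(G).Finite) (hE : E(G).Finite)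
    (hab : ∀ e ∈ E(G), G.IsLink e (a e) (b e)) {k : ℕ} (hk : 2 ≤ k)
    {f : α → ZMod k} (hf : IsCompatible G f) {B : Graph α β} (hBG : B ≤s G) (hB : IsBipartite B)
    (hBconn : IsEdgeConnected B (3 * k - 3)) :
    ∃ H : Graph α β, IsModFactor G f H ∧ ∀ v ∈ V(G),
      -(2 * (k : ℤ)) < 2 * (degree H v : ℤ) - degree G v ∧
        2 * (degree H v : ℤ) - degree G v ≤ 2 * k := by
  have : NeZero k := ⟨by omega⟩
  obtain ⟨X, Y, ⟨hXY, hVB⟩, hcross⟩ := hB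
  rw [hBG.vertexSet_eq] at hVB
  set I := hE.toFinset with hI
  set S := hV.toFinset with hS
  have hXS : X ⊆ S := by rw [hS, hV.coe_toFinset, ← hVB]; exact Set.subset_union_left
  have hYS : Y ⊆ S := by rw [hS, hV.coe_toFinset, ← hVB]; exact Set.subset_union_right
  have hmemY : ∀ v ∈ V(G), (v ∈ Y ↔ v ∉ X) := fun v hv => by
    rw [← hVB] at hv
    exact ⟨fun h h' => Set.disjoint_left.1 hXY h' h, fun h => hv.resolve_left h⟩
  have hmemS : ∀ v, v ∈ S ↔ v ∈ V(G) := fun v => by simp [hS]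
  have hmemI : ∀ e, e ∈ I ↔ e ∈ E(G) := fun e => by simp [hI]
  let ε : α → ℤ := fun v => if v ∈ X then 1 else -1
  have hε : ∀ v, |ε v| = 1 := fun v => by simp only [ε]; split_ifs <;> simp
  have hεε : ∀ v, ε v * ε v = 1 := fun v => by rw [← abs_mul_abs_self, hε]; rfl
  let N := I.filter fun e => ¬ (a e ∈ X ↔ b e ∈ X)
  let P := I.filter fun e => (a e ∈ X ↔ b e ∈ X)
  have hends : ∀ e ∈ I, a e ∈ S ∧ b e ∈ S := fun e he => by
    have := hab e ((hmemI e).1 he)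
    exact ⟨(hmemS _).2 this.left_mem, (hmemS _).2 this.right_mem⟩
  have hsplit : ∀ g : β → ℤ, ∑ e ∈ N, g e + ∑ e ∈ P, g e = ∑ e ∈ I, g e := fun g => by
    rw [add_comm]; exact Finset.sum_filter_add_sum_filter_not _ _ _
  let T : α → ℤ := fun v => ε v * (2 * ((f v).val : ℤ) - degree G v)
  have hsig : IsSignable (k : ℤ) S N P a b T := by
    refine ⟨?_, fun e he => hends e (Finset.mem_filter.1 he).1,
      fun e he => hends e (Finset.mem_filter.1 he).1, fun v _ => ?_, fun A hA hne hAS => ?_, ?_⟩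
    · exact (Finset.disjoint_filter_filter_not _ _ _).symm
    · rw [incidences, incidences, hsplit, ← degree_eq_sum hE hab]
      simp only [T, ε]
      split_ifs <;> omega
    · have h1 := hBconn A (fun v hv => by rw [hBG.vertexSet_eq]; exact (hmemS v).1 (hA hv))
        (by simpa using hne) (fun e => hAS (by
          rw [hBG.vertexSet_eq] at e
          ext v
          rw [hmemS, ← e, Finset.mem_coe]))
      -- All edges of `B` run between the sides, so they belong to `N`, which inherits the
      -- connectivity of `B`.
      have h2 : cutSize B A ≤ (N.filter fun e => ¬ (a e ∈ A ↔ b e ∈ A)).card := by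
        rw [cutSize, ← Set.ncard_coe_finset]
        refine Set.ncard_le_ncard ?_ (Finset.finite_toSet _)
        rintro e ⟨x, hx, y, hy, hl⟩
        have hl' : G.IsLink e x y := hl.mono hBG.le
        have hx' := hmemY x hl'.left_mem
        have hy' := hmemY y hl'.right_mem
        have hc := hcross e x y hl
        rw [Finset.mem_coe] at hx hy
        simp only [N, Finset.coe_filter, Finset.mem_filter, Set.mem_ofPred_eq, hmemI]
        refine ⟨⟨hl'.edge_mem, ?_⟩, ?_⟩ <;>
        rcases hl'.eq_and_eq_or_eq_and_eq (hab e hl'.edge_mem) with ⟨h, h'⟩ | ⟨h, h'⟩ <;>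
        rw [← h, ← h'] <;> tauto
      have h3 : ∑ e ∈ N, (if (a e ∈ A ↔ b e ∈ A) then (0 : ℤ) else 1) =
          (N.filter fun e => ¬ (a e ∈ A ↔ b e ∈ A)).card := by
        rw [Finset.card_filter, Nat.cast_sum]
        refine Finset.sum_congr rfl fun e _ => ?_
        split_ifs <;> simp_all
      rw [h3]
      omega
    · let W : ℤ := ∑ v ∈ S, ε v * ((f v).val : ℤ)
      have hW : (W : ZMod k) = ∑ᶠ v ∈ X, f v - ∑ᶠ v ∈ Y, f v := by
        rw [finsum_mem_eq_sum_ite hXS, finsum_mem_eq_sum_ite hYS, ← Finset.sum_sub_distrib,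
          Int.cast_sum]
        refine Finset.sum_congr rfl fun v hv => ?_
        have := hmemY v ((hmemS v).1 hv)
        by_cases h : v ∈ X <;> simp [ε, h, this]
      have hcard : (P.card : ℤ) = edgesInside G X + edgesInside G Y := by
        rw [edgesInside_eq_sum hE hab, edgesInside_eq_sum hE hab, Finset.card_filter,
          ← Nat.cast_add, ← Finset.sum_add_distrib]
        congr 1
        refine Finset.sum_congr rfl fun e he => ?_
        have h1 := hmemY _ ((hmemS _).1 (hends e he).1)
        have h2 := hmemY _ ((hmemS _).1 (hends e he).2)
        by_cases h : a e ∈ X <;> by_cases h' : b e ∈ X <;> simp [h, h', h1, h2]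
      have hdeg : ∑ v ∈ S, ε v * (degree G v : ℤ) =
          2 * edgesInside G X - 2 * edgesInside G Y := by
        rw [edgesInside_eq_sum hE hab, edgesInside_eq_sum hE hab, Nat.cast_sum, Nat.cast_sum,
          Finset.mul_sum, Finset.mul_sum, ← Finset.sum_sub_distrib]
        simp_rw [degree_eq_sum hE hab, Finset.mul_sum]
        rw [Finset.sum_comm]
        refine Finset.sum_congr rfl fun e he => ?_
        obtain ⟨ha, hb⟩ := hends e he
        have h1 := hmemY _ ((hmemS _).1 ha)
        have h2 := hmemY _ ((hmemS _).1 hb)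
        have h3 : ∀ u ∈ S, ∑ v ∈ S, ε v * vertInd u v = ε u := fun u hu => by
          simp [vertInd, hu]
        simp_rw [mul_add]
        rw [Finset.sum_add_distrib, h3 _ ha, h3 _ hb]
        by_cases h : a e ∈ X <;> by_cases h' : b e ∈ X <;> simp [ε, h, h', h1, h2]
      have hT : ∑ v ∈ S, T v = 2 * W - (2 * edgesInside G X - 2 * edgesInside G Y) := by
        rw [← hdeg, Finset.mul_sum, ← Finset.sum_sub_distrib]
        exact Finset.sum_congr rfl fun v _ => by simp only [T]; ring
      rw [hT, hcard]
      rcases hf X Y ⟨hXY, hVB⟩ with ⟨x, hx, h⟩ | ⟨y, hy, h⟩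
      · have hd : (k : ℤ) ∣ W - 2 * x := by
          rw [← ZMod.intCast_zmod_eq_zero_iff_dvd]
          push_cast
          rw [hW, ← h]
          ring
        obtain ⟨c, hc⟩ := hd
        -- Models a factor with `x` edges inside `X` and none inside `Y`: after the twist, edges of
        -- `Y` outside the factor are positive.
        refine ⟨x + edgesInside G Y, by positivity, by omega, c, ?_⟩
        linear_combination 2 * hc
      · have hd : (k : ℤ) ∣ W + 2 * y := by
          rw [← ZMod.intCast_zmod_eq_zero_iff_dvd]
          push_cast
          rw [hW, h]
          ring
        obtain ⟨c, hc⟩ := hd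
        -- Here the factor uses `y` edges inside `Y`, which become negative, and none inside `X`.
        refine ⟨edgesInside G Y - y, by omega, by omega, c, ?_⟩
        linear_combination 2 * hc
  obtain ⟨s', hs', hsv⟩ := hsig.exists_signs_of_sides (by exact_mod_cast hk) hε (fun e he => by
    have := (Finset.mem_filter.1 he).2
    simp only [ε, this])
  -- Undoing the twist: on an edge of `N` both the sign and `ε` change between the ends, so both
  -- ends receive the same value `s e`.
  let s : β → ℤ := fun e => ε (a e) * s' e
  have hs : ∀ e, |s e| = 1 := fun e => by simp only [s]; rw [abs_mul, hε, hs']; rfl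
  have hnet : ∀ v, ε v * netDegree N P a b s' v =
      2 * (degree (G.restrict {e | s e = 1}) v : ℤ) - degree G v := fun v => by
    have hv : ∀ u, ε v * vertInd u v = ε u * vertInd u v := fun u => by
      unfold vertInd
      split_ifs with h
      · rw [h]
      · simp
    rw [two_mul_degree_restrict_sub hE hab hs, netDegree, mul_add, Finset.mul_sum, Finset.mul_sum,
      ← hsplit]
    congr 1
    · refine Finset.sum_congr rfl fun e he => ?_
      have h := (Finset.mem_filter.1 he).2
      have hab' : ε (b e) = -ε (a e) := by
        simp only [ε]
        split_ifs <;> simp_all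
      have h1 := hv (a e)
      have h2 := hv (b e)
      rw [hab'] at h2
      simp only [s]
      linear_combination s' e * (h1 - h2)
    · refine Finset.sum_congr rfl fun e he => ?_
      have h := (Finset.mem_filter.1 he).2
      have hab' : ε (b e) = ε (a e) := by simp only [ε, h]
      have h1 := hv (a e)
      have h2 := hv (b e)
      rw [hab'] at h2
      simp only [s]
      linear_combination s' e * (h1 + h2)
  refine ⟨G.restrict {e | s e = 1}, ⟨restrict_isSpanningSubgraph _, fun v hv => ?_⟩,
    fun v hv => ?_⟩
  · obtain ⟨c, hc⟩ := (hsv v ((hmemS v).2 hv)).1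
    have hd : (k : ℤ) ∣ (degree (G.restrict {e | s e = 1}) v : ℤ) - ((f v).val : ℤ) := by
      refine ⟨ε v * c, ?_⟩
      have h1 := hnet v
      simp only [T] at hc
      have h2 := hεε v
      refine mul_left_cancel₀ (two_ne_zero' ℤ) ?_
      linear_combination ε v * hc - h1 + (2 * ((f v).val : ℤ) - degree G v) * h2
    rw [← ZMod.intCast_zmod_eq_zero_iff_dvd] at hd
    push_cast at hd
    rw [ZMod.natCast_zmod_val] at hd
    exact sub_eq_zero.1 hd
  · rw [← hnet]
    exact (hsv v ((hmemS v).2 hv)).2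

end Factor

end ModuloFactor

/-! ### The main theorem -/

theorem mainTheorem2 {α β : Type*} (G : Graph α β) (hV : V(G).Finite) (hE : E(G).Finite)
    (k : ℕ) (hk : 0 < k) (f : α → ZMod k) (hf : ModuloFactor.IsCompatible G f)
    (hB : ∃ B : Graph α β, B ≤s G ∧ ModuloFactor.IsBipartite B ∧
      ModuloFactor.IsEdgeConnected B (3 * k - 3)) :
    ∃ H : Graph α β, ModuloFactor.IsModFactor G f H ∧
      ∀ v ∈ V(G),
        ((ModuloFactor.degree G v / 2 : ℕ) : ℤ) - ((k : ℤ) - 1) ≤ (ModuloFactor.degree H v : ℤ) ∧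
        (ModuloFactor.degree H v : ℤ) ≤ ((ModuloFactor.degree G v / 2 : ℕ) : ℤ) + (k : ℤ) := by
  -- Choosing ends `a e`, `b e` for every label `e`, edge or not, requires a vertex type with an
  -- element.
  rcases isEmpty_or_nonempty α with h | h
  · exact ⟨G, ⟨⟨le_refl G, rfl⟩, fun v => h.elim v⟩, fun v => h.elim v⟩
  choose! a b hab using fun e => Graph.exists_isLink_of_mem_edgeSet (G := G) (e := e)
  -- In both cases `2 d_H(v) - d_G(v)` lies in `(-2k, 2k]`, which rounds to the stated bounds around
  -- `⌊d_G(v) / 2⌋`.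
  rcases (show k = 1 ∨ 2 ≤ k by omega) with rfl | hk2
  · obtain ⟨H, hH, hdeg⟩ := ModuloFactor.exists_modFactor_of_one hE hab f
    exact ⟨H, hH, fun v _ => by have := hdeg v; omega⟩
  · obtain ⟨B, hBG, hBip, hBconn⟩ := hB
    obtain ⟨H, hH, hdeg⟩ := ModuloFactor.exists_modFactor_of_two_le hV hE hab hk2 hf hBG hBip hBconn
    exact ⟨H, hH, fun v hv => by have := hdeg v hv; omega⟩
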